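/- Let $(\mathcal A,\mathcal E)$ be an exact category in the sense of Quillen whose underlying additive category is weakly idempotent complete (every split monomorphism has a cokernel), and suppose that it has enough injectives. Let $(\mathcal W,\mathcal F)$ be an injective cotorsion pair in $\mathcal A$, that is, a complete cotorsion pair such that $\mathcal W$ is thick (closed under retracts and with the two-out-of-three property on admissible short exact sequences) and $\mathcal W\cap\mathcal F$ is the class of injective objects of $\mathcal A$. Call a morphism a weak equivalence if it is an admissible monomorphism with cokernel in $\mathcal W$ followed by an admissible epimorphism with kernel in $\mathcal W\cap\mathcal F$, and let $\gamma:\mathcal A\to\mathcal A/\mathcal W$ be the localization of $\mathcal A$ at the weak equivalences. For morphisms $f,g$ of the full subcategory $\mathcal F$ write $f\sim g$ if $g-f$ factors through an object of $\mathcal W\cap\mathcal F$. 1. The full subcategory $\mathcal F$, with the admissible short exact sequences of $\mathcal A$ all of whose terms lie in $\mathcal F$, is a Frobenius category (an exact category with enough projectives and enough injectives in which projectives and injectives coincide). Its projective-injective objects are precisely the injective objects of $\mathcal A$. 2. The inclusion of $\mathcal F$ induces an equivalence $\mathcal F/{\sim}\,\simeq\,\mathcal A/\mathcal W$. The category $\mathcal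 A/\mathcal W$ is triangulated, with the structure corresponding to the usual one on the stable category of the Frobenius category $\mathcal F$: the suspension of $X\in\mathcal F$ is given, naturally, by the admissible short exact sequences $X\rightarrowtail I\twoheadrightarrow\Sigma X$ in $\mathcal F$ with $I$ injective, and the exact triangles are those isomorphic to a triangle $X\to Y\to Z\xrightarrow{c}\Sigma X$ coming from an admissible short exact sequence $X\rightarrowtail Y\twoheadrightarrow Z$ in $\mathcal F$ and a morphism $(1_X,e,c)$ from it to a sequence $X\rightarrowtail I\twoheadrightarrow\Sigma X$ as above. The functor $\gamma$ is exact: for each admissible short exact sequence $A\xrightarrow{f}B\xrightarrow{g}C$ in $\mathcal A$ there is a morphism $\delta:\gamma(C)\to\Sigma\gamma(A)$ such that $\gamma(A)\xrightarrow{\gamma(f)}\gamma(B)\xrightarrow{\gamma(g)}\gamma(C)\xrightarrow{\delta}\Sigma\gamma(A)$ is an exact triangle. 3. $\gamma$ sends all objects of $\mathcal W$ to zero objects, and it is universal with this property: if $\mathcal T$ is a triangulated category and $G:\mathcal A\to\mathcal T$ is a functor that takes admissible short exact sequences to exact triangles (in the sense of 2) and sends all objects of $\mathcal W$ to zero objects,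 then there is a unique functor $H:\mathcal A/\mathcal W\to\mathcal T$ with $H\circ\gamma=G$. Moreover, for every exact triangle $X\xrightarrow{u}Y\xrightarrow{v}Z\to\Sigma X$ in $\mathcal A/\mathcal W$ there is a morphism $\delta$ such that $H(X)\xrightarrow{H(u)}H(Y)\xrightarrow{H(v)}H(Z)\xrightarrow{\delta}\Sigma H(X)$ is an exact triangle in $\mathcal T$. -/

import Mathlib

open CategoryTheory CategoryTheory.Limits CategoryTheory.Pretriangulated

universe v u v₂ u₂

namespace ExactCat

section Exact

variable {C : Type u} [Category.{v} C] [Preadditive C]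

/-- A kernel-cokernel pair. -/
def IsKernelCokernelPair (S : ShortComplex C) : Prop :=
  Nonempty (IsLimit (KernelFork.ofι S.f S.zero)) ∧
    Nonempty (IsColimit (CokernelCofork.ofπ S.g S.zero))

/-- `i` is an admissible monomorphism for the class `E` of admissible short exact sequences. -/
def AdmissibleMono (E : ObjectProperty (ShortComplex C)) {X Y : C} (i : X ⟶ Y) : Prop :=
  ∃ (Z : C) (p : Y ⟶ Z) (w : i ≫ p = 0), E (ShortComplex.mk i p w)

/-- `p` is an admissible epimorphism for the class `E` of admissible short exact sequences. -/
def AdmissibleEpi (E : ObjectProperty (ShortComplex C)) {Y Z : C} (p : Y ⟶ Z) : Prop :=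
  ∃ (X : C) (i : X ⟶ Y) (w : i ≫ p = 0), E (ShortComplex.mk i p w)

/-- `(C, E)` is an exact category in the sense of Quillen: `C` is additive and `E` is a class of
kernel-cokernel pairs satisfying the usual axioms. -/
structure IsExactCategory (E : ObjectProperty (ShortComplex C)) : Prop where
  hasZeroObject : HasZeroObject C
  hasBinaryBiproducts : HasBinaryBiproducts C
  kernelCokernel : ∀ S : ShortComplex C, E S → IsKernelCokernelPair S
  closedUnderIso : ∀ S S' : ShortComplex C, Nonempty (S ≅ S') → E S → E S'
  split : ∀ S : ShortComplex C, Nonempty S.Splitting → E S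
  mono_comp : ∀ {X Y Z : C} (i : X ⟶ Y) (j : Y ⟶ Z),
    AdmissibleMono E i → AdmissibleMono E j → AdmissibleMono E (i ≫ j)
  epi_comp : ∀ {X Y Z : C} (p : X ⟶ Y) (q : Y ⟶ Z),
    AdmissibleEpi E p → AdmissibleEpi E q → AdmissibleEpi E (p ≫ q)
  pushout : ∀ {X Y X' : C} (i : X ⟶ Y) (f : X ⟶ X'), AdmissibleMono E i →
    ∃ (Y' : C) (f' : Y ⟶ Y') (i' : X' ⟶ Y'), IsPushout i f f' i' ∧ AdmissibleMono E i'
  pullback : ∀ {Y Z Z' : C} (p : Y ⟶ Z) (f : Z' ⟶ Z), AdmissibleEpi E p →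
    ∃ (Y' : C) (f' : Y' ⟶ Y) (p' : Y' ⟶ Z'), IsPullback f' p' p f ∧ AdmissibleEpi E p'

variable (C) in
/-- Every split monomorphism has a cokernel. -/
def IsWeaklyIdempotentComplete : Prop :=
  ∀ {X Y : C} (f : X ⟶ Y), IsSplitMono f → HasCokernel f

/-- Injective objects relative to the admissible monomorphisms. -/
def IsInjective (E : ObjectProperty (ShortComplex C)) (I : C) : Prop :=
  ∀ {X Y : C} (i : X ⟶ Y) (f : X ⟶ I), AdmissibleMono E i → ∃ g : Y ⟶ I, i ≫ g = f

/-- Projective objects relative to the admissible epimorphisms. -/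
def IsProjective (E : ObjectProperty (ShortComplex C)) (P : C) : Prop :=
  ∀ {Y Z : C} (p : Y ⟶ Z) (f : P ⟶ Z), AdmissibleEpi E p → ∃ g : P ⟶ Y, g ≫ p = f

def HasEnoughInjectives (E : ObjectProperty (ShortComplex C)) : Prop :=
  ∀ X : C, ∃ (I : C) (i : X ⟶ I), IsInjective E I ∧ AdmissibleMono E i

def HasEnoughProjectives (E : ObjectProperty (ShortComplex C)) : Prop :=
  ∀ X : C, ∃ (P : C) (p : P ⟶ X), IsProjective E P ∧ AdmissibleEpi E p

/-- `(C, E)` is a Frobenius category. -/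
structure IsFrobenius (E : ObjectProperty (ShortComplex C)) : Prop where
  exact : IsExactCategory E
  enoughInjectives : HasEnoughInjectives E
  enoughProjectives : HasEnoughProjectives E
  projective_iff_injective : ∀ X : C, IsProjective E X ↔ IsInjective E X

/-- The Yoneda group `Ext¹(X, Y)` vanishes: every admissible short exact sequence
`Y ↣ Z ↠ X` splits. -/
def ExtVanishes (E : ObjectProperty (ShortComplex C)) (X Y : C) : Prop :=
  ∀ (Z : C) (i : Y ⟶ Z) (p : Z ⟶ X) (w : i ≫ p = 0),
    E (ShortComplex.mk i p w) → Nonempty (ShortComplex.mk i p w).Splitting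

/-- `(W, F)` is a cotorsion pair: each class is the `Ext¹`-orthogonal of the other. -/
structure IsCotorsionPair (E : ObjectProperty (ShortComplex C)) (W F : ObjectProperty C) :
    Prop where
  left_iff : ∀ X : C, W X ↔ ∀ Y : C, F Y → ExtVanishes E X Y
  right_iff : ∀ Y : C, F Y ↔ ∀ X : C, W X → ExtVanishes E X Y

/-- A complete cotorsion pair: one with enough projectives and enough injectives. -/
structure IsCompleteCotorsionPair (E : ObjectProperty (ShortComplex C)) (W F : ObjectProperty C) :
    Prop extends IsCotorsionPair E W F where
  enoughProjectives : ∀ X : C, ∃ S : ShortComplex C,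
    E S ∧ F S.X₁ ∧ W S.X₂ ∧ Nonempty (S.X₃ ≅ X)
  enoughInjectives : ∀ X : C, ∃ S : ShortComplex C,
    E S ∧ Nonempty (S.X₁ ≅ X) ∧ F S.X₂ ∧ W S.X₃

/-- A class of objects is thick if it is closed under retracts and if, whenever two of the three
terms of an admissible short exact sequence are in it, so is the third. -/
structure IsThick (E : ObjectProperty (ShortComplex C)) (W : ObjectProperty C) : Prop where
  retract : W.IsStableUnderRetracts
  left : ∀ S : ShortComplex C, E S → W S.X₂ → W S.X₃ → W S.X₁
  middle : ∀ S : ShortComplex C, E S → W S.X₁ → W S.X₃ → W S.X₂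
  right : ∀ S : ShortComplex C, E S → W S.X₁ → W S.X₂ → W S.X₃

/-- An injective cotorsion pair: a complete cotorsion pair `(W, F)` with `W` thick and
`W ∩ F` equal to the class of injective objects. -/
structure IsInjectiveCotorsionPair (E : ObjectProperty (ShortComplex C))
    (W F : ObjectProperty C) : Prop where
  complete : IsCompleteCotorsionPair E W F
  thick : IsThick E W
  inter_iff : ∀ X : C, (W X ∧ F X) ↔ IsInjective E X

/-- The class of short sequences of the full subcategory `F` which are admissible in the
ambient category. -/
def restrict (E : ObjectProperty (ShortComplex C)) (F : ObjectProperty C) :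
    ObjectProperty (ShortComplex F.FullSubcategory) :=
  fun S => E (ShortComplex.mk (F.ι.map S.f) (F.ι.map S.g)
    (by rw [← F.ι.map_comp, S.zero, F.ι.map_zero]))

/-- The trivial cofibrations of the model structure `(all, W, F)`: the admissible monomorphisms
with cokernel in `W`. -/
def trivialCofibrations (E : ObjectProperty (ShortComplex C)) (W : ObjectProperty C) :
    MorphismProperty C :=
  fun _ Y i => ∃ (Z : C) (p : Y ⟶ Z) (w : i ≫ p = 0), E (ShortComplex.mk i p w) ∧ W Z

/-- The trivial fibrations of the model structure `(all, W, F)`: the admissible epimorphisms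
with kernel in `W ∩ F`. -/
def trivialFibrations (E : ObjectProperty (ShortComplex C)) (W F : ObjectProperty C) :
    MorphismProperty C :=
  fun Y _ p => ∃ (X : C) (i : X ⟶ Y) (w : i ≫ p = 0), E (ShortComplex.mk i p w) ∧ W X ∧ F X

/-- The weak equivalences of the model structure `(all, W, F)`: the trivial cofibrations followed
by trivial fibrations. -/
def weakEquivalences (E : ObjectProperty (ShortComplex C)) (W F : ObjectProperty C) :
    MorphismProperty C :=
  fun X Y g => ∃ (Z : C) (i : X ⟶ Z) (p : Z ⟶ Y),
    trivialCofibrations E W i ∧ trivialFibrations E W F p ∧ i ≫ p = g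

/-- The homotopy category `A/W`, obtained by formally inverting the weak equivalences. -/
abbrev HomotopyCategory (E : ObjectProperty (ShortComplex C)) (W F : ObjectProperty C) :=
  (weakEquivalences E W F).Localization

/-- The localization functor `γ : A ⥤ A/W`. -/
abbrev localizationFunctor (E : ObjectProperty (ShortComplex C)) (W F : ObjectProperty C) :
    C ⥤ HomotopyCategory E W F :=
  (weakEquivalences E W F).Q

/-- The relation `f ∼ g` on morphisms of the full subcategory `F`: the difference `g - f`
factors through an object of `W ∩ F`. -/
def homotopic (W F : ObjectProperty C) : HomRel F.FullSubcategory :=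
  fun X Y f g => ∃ (I : F.FullSubcategory) (a : X ⟶ I) (b : I ⟶ Y), W I.obj ∧ a ≫ b = g - f

/-- The quotient category `F/∼`. -/
abbrev StableCategory (W F : ObjectProperty C) := Quotient (homotopic W F)

end Exact

section Triangulated

variable {C : Type u} [Category.{v} C] [Preadditive C]
variable {D : Type u₂} [Category.{v₂} D] [Preadditive D] [HasZeroObject D] [HasShift D ℤ]
  [∀ n : ℤ, (shiftFunctor D n).Additive] [Pretriangulated D]

/-- Let `(C, E)` be a Frobenius category and let `π : C ⥤ D` identify `D` with its stable
category, up to equivalence. This says that the (pre)triangulated structure of `D` is the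
standard one of a stable category:
* `π` is additive;
* the suspension of `X` is computed by the admissible short exact sequences `X ↣ I ↠ ΣX` with `I`
  injective, naturally with respect to morphisms of such sequences;
* the distinguished triangles are those isomorphic to the triangles
  `X ⟶ Y ⟶ Z ⟶ ΣX` obtained from an admissible short exact sequence `X ↣ Y ↠ Z` and a morphism
  `(𝟙 X, e, c)` from it to a sequence `X ↣ I ↠ ΣX` as above. -/
def IsStableTriangulation (E : ObjectProperty (ShortComplex C)) (π : C ⥤ D) : Prop :=
  π.Additive ∧
  ∃ σ : ∀ S : ShortComplex C, E S → IsInjective E S.X₂ →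
      (π.obj S.X₃ ≅ (π.obj S.X₁)⟦(1 : ℤ)⟧),
    (∀ (S S' : ShortComplex C) (hS : E S) (hI : IsInjective E S.X₂) (hS' : E S')
        (hI' : IsInjective E S'.X₂) (φ : S ⟶ S'),
      π.map φ.τ₃ ≫ (σ S' hS' hI').hom = (σ S hS hI).hom ≫ (π.map φ.τ₁)⟦(1 : ℤ)⟧') ∧
    (∀ T : Triangle D, T ∈ distTriang D ↔
      ∃ (S : ShortComplex C) (_ : E S) (I Z : C) (i : S.X₁ ⟶ I) (p : I ⟶ Z) (w : i ≫ p = 0)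
        (hS' : E (ShortComplex.mk i p w)) (hI : IsInjective E I)
        (e : S.X₂ ⟶ I) (c : S.X₃ ⟶ Z) (_ : S.f ≫ e = i) (_ : S.g ≫ c = e ≫ p),
        Nonempty (T ≅ Triangle.mk (π.map S.f) (π.map S.g)
          (π.map c ≫ (σ (ShortComplex.mk i p w) hS' hI).hom)))

/-- A functor from an exact category to a triangulated category is exact if it takes
admissible short exact sequences to exact triangles. -/
def IsExactFunctor (E : ObjectProperty (ShortComplex C)) (G : C ⥤ D) : Prop :=
  ∀ S : ShortComplex C, E S → ∃ δ : G.obj S.X₃ ⟶ (G.obj S.X₁)⟦(1 : ℤ)⟧,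
    Triangle.mk (G.map S.f) (G.map S.g) δ ∈ distTriang D

end Triangulated

end ExactCat

/-! Everything rests on two closure properties of `F`: under extensions (`right_extension`) and
under cokernels of admissible monomorphisms (`right_cokernel`, where thickness of `W` enters). They
let `F` inherit the axioms of an exact category. An object of `F` embeds in an injective with
cokernel in `F`; it is also covered by an object of `W ∩ F` with kernel in `F`, and objects of `W`
are projective relative to `F` because `Ext¹(W, F) = 0`. As `W ∩ F` is the class of injectives, `F`
is Frobenius.

A fibrant replacement `X ↣ R`, with `R` in `F` and cokernel in `W`, is unique and functorial up to
`∼` (`homotopic_of_comp_eq`). The resulting functor to `F/∼` inverts weak equivalences and is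
quasi-inverse to the functor induced by the inclusion. Only trivial cofibrations have to be tested,
since trivial fibrations split (`isInvertedBy_weakEquivalences`).

The triangulation is built for any functor `π` that presents its target as the stable category of a
Frobenius category (`IsStableQuotient.exists_triangulation`). Each conflation has a natural
connecting morphism `δ`, and the triangles are those isomorphic to some `(π f, π g, δ)`. Rotation
comes from the conflation attached to a pushout or pullback square, the octahedral axiom from the
third isomorphism theorem. The suspension is a priori a mere autoequivalence; it is rigidified to an
action of `ℤ` through spectra (`exists_hasShift`).

Every conflation of the ambient category maps by trivial cofibrations to a conflation in `F`, whence
`γ` is exact. An exact functor killing `W` inverts trivial cofibrations, so it factors uniquely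
through `γ`; the factorization preserves triangles because each of them comes from a conflation in
`F`. -/

namespace ExactCat

/-! ### Diagram lemmas in an exact category -/

section Conflations

variable {C : Type u} [Category.{v} C] [Preadditive C]

/-- The pair `(i, p)` is an admissible short exact sequence. -/
def Conf (E : ObjectProperty (ShortComplex C)) {X Y Z : C} (i : X ⟶ Y) (p : Y ⟶ Z) : Prop :=
  ∃ w : i ≫ p = 0, E (ShortComplex.mk i p w)

variable {E : ObjectProperty (ShortComplex C)}

lemma Conf.w {X Y Z : C} {i : X ⟶ Y} {p : Y ⟶ Z} (h : Conf E i p) : i ≫ p = 0 := h.1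

lemma Conf.admissibleMono {X Y Z : C} {i : X ⟶ Y} {p : Y ⟶ Z} (h : Conf E i p) :
    AdmissibleMono E i := ⟨Z, p, h.1, h.2⟩

lemma Conf.admissibleEpi {X Y Z : C} {i : X ⟶ Y} {p : Y ⟶ Z} (h : Conf E i p) :
    AdmissibleEpi E p := ⟨X, i, h.1, h.2⟩

lemma AdmissibleMono.conf {X Y : C} {i : X ⟶ Y} (h : AdmissibleMono E i) :
    ∃ (Z : C) (p : Y ⟶ Z), Conf E i p := by
  obtain ⟨Z, p, w, h⟩ := h
  exact ⟨Z, p, w, h⟩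

lemma AdmissibleEpi.conf {Y Z : C} {p : Y ⟶ Z} (h : AdmissibleEpi E p) :
    ∃ (X : C) (i : X ⟶ Y), Conf E i p := by
  obtain ⟨X, i, w, h⟩ := h
  exact ⟨X, i, w, h⟩

namespace IsExactCategory

variable (hE : IsExactCategory E)
include hE

lemma mono {X Y Z : C} {i : X ⟶ Y} {p : Y ⟶ Z} (h : Conf E i p) : Mono i := by
  obtain ⟨⟨hl⟩, -⟩ := hE.kernelCokernel _ h.2
  exact mono_of_isLimit_fork hl

lemma epi {X Y Z : C} {i : X ⟶ Y} {p : Y ⟶ Z} (h : Conf E i p) : Epi p := by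
  obtain ⟨-, ⟨hl⟩⟩ := hE.kernelCokernel _ h.2
  exact epi_of_isColimit_cofork hl

lemma lift {X Y Z T : C} {i : X ⟶ Y} {p : Y ⟶ Z} (h : Conf E i p) (f : T ⟶ Y)
    (hf : f ≫ p = 0) : ∃ g : T ⟶ X, g ≫ i = f := by
  obtain ⟨⟨hl⟩, -⟩ := hE.kernelCokernel _ h.2
  exact ⟨_, (KernelFork.IsLimit.lift' hl f hf).2⟩

lemma desc {X Y Z T : C} {i : X ⟶ Y} {p : Y ⟶ Z} (h : Conf E i p) (f : Y ⟶ T)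
    (hf : i ≫ f = 0) : ∃ g : Z ⟶ T, p ≫ g = f := by
  obtain ⟨-, ⟨hl⟩⟩ := hE.kernelCokernel _ h.2
  exact ⟨_, (CokernelCofork.IsColimit.desc' hl f hf).2⟩

lemma conf_of_iso {X Y Z X' Y' Z' : C} {i : X ⟶ Y} {p : Y ⟶ Z} (h : Conf E i p)
    {i' : X' ⟶ Y'} {p' : Y' ⟶ Z'} (e₁ : X ≅ X') (e₂ : Y ≅ Y') (e₃ : Z ≅ Z')
    (h₁ : e₁.hom ≫ i' = i ≫ e₂.hom) (h₂ : e₂.hom ≫ p' = p ≫ e₃.hom) : Conf E i' p' := by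
  have w : i' ≫ p' = 0 := by
    rw [← cancel_epi e₁.hom, reassoc_of% h₁, h₂, reassoc_of% h.w]
    simp
  exact ⟨w, hE.closedUnderIso _ _ ⟨ShortComplex.isoMk e₁ e₂ e₃ h₁ h₂⟩ h.2⟩

/-- An admissible monomorphism together with any cokernel is a conflation. -/
lemma conf_of_cokernel {X Y Z : C} {i : X ⟶ Y} {p : Y ⟶ Z} (hi : AdmissibleMono E i)
    (w : i ≫ p = 0) [Epi p] (hp : ∀ {T : C} (f : Y ⟶ T), i ≫ f = 0 → ∃ g, p ≫ g = f) :
    Conf E i p := by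
  obtain ⟨Z', p', h⟩ := hi.conf
  have := hE.epi h
  obtain ⟨a, ha⟩ := hE.desc h p w
  obtain ⟨b, hb⟩ := hp p' h.w
  exact hE.conf_of_iso h (Iso.refl _) (Iso.refl _)
    ⟨a, b, by rw [← cancel_epi p', reassoc_of% ha, hb, Category.comp_id],
      by rw [← cancel_epi p, reassoc_of% hb, ha, Category.comp_id]⟩ (by simp) (by simp [ha])

/-- An admissible epimorphism together with any kernel is a conflation. -/
lemma conf_of_kernel {X Y Z : C} {i : X ⟶ Y} {p : Y ⟶ Z} (hp : AdmissibleEpi E p)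
    (w : i ≫ p = 0) [Mono i] (hi : ∀ {T : C} (f : T ⟶ Y), f ≫ p = 0 → ∃ g, g ≫ i = f) :
    Conf E i p := by
  obtain ⟨X', i', h⟩ := hp.conf
  have := hE.mono h
  obtain ⟨a, ha⟩ := hE.lift h i w
  obtain ⟨b, hb⟩ := hi i' h.w
  exact hE.conf_of_iso h
    ⟨b, a, by rw [← cancel_mono i', Category.assoc, ha, hb, Category.id_comp],
      by rw [← cancel_mono i, Category.assoc, hb, ha, Category.id_comp]⟩
    (Iso.refl _) (Iso.refl _) (by simp [hb]) (by simp)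

lemma conf_of_splitting {X Y Z : C} {i : X ⟶ Y} {p : Y ⟶ Z} (w : i ≫ p = 0)
    (s : (ShortComplex.mk i p w).Splitting) : Conf E i p := ⟨w, hE.split _ ⟨s⟩⟩

lemma admissibleMono_of_isIso {X Y : C} (f : X ⟶ Y) [IsIso f] : AdmissibleMono E f := by
  obtain ⟨Z, hZ⟩ := hE.hasZeroObject
  exact ⟨Z, 0, by simp, hE.split _ ⟨⟨inv f, 0, by simp, hZ.eq_of_src _ _, by simp⟩⟩⟩

lemma admissibleEpi_of_isIso {X Y : C} (f : X ⟶ Y) [IsIso f] : AdmissibleEpi E f := by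
  obtain ⟨Z, hZ⟩ := hE.hasZeroObject
  exact ⟨Z, 0, by simp, hE.split _ ⟨⟨0, inv f, hZ.eq_of_src _ _, by simp, by simp⟩⟩⟩

/-- The axiom provides one pushout with an admissible leg; uniqueness of pushouts moves
admissibility to the given square, and pushing out does not change the cokernel. -/
lemma exists_conf_of_isPushout {X Y Z X' Y' : C} {i : X ⟶ Y} {p : Y ⟶ Z} (h : Conf E i p)
    {f : X ⟶ X'} {f' : Y ⟶ Y'} {i' : X' ⟶ Y'} (hP : IsPushout i f f' i') :
    ∃ p' : Y' ⟶ Z, Conf E i' p' ∧ f' ≫ p' = p := by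
  obtain ⟨Y'', f'', i'', hP', hi''⟩ := hE.pushout i f h.admissibleMono
  have hi' : AdmissibleMono E i' := by
    have := hE.mono_comp _ _ hi'' (hE.admissibleMono_of_isIso (hP'.isoIsPushout _ _ hP).hom)
    simpa using this
  have := hE.epi h
  let p' : Y' ⟶ Z := hP.desc p 0 (by simp [h.w])
  have h₁ : f' ≫ p' = p := hP.inl_desc _ _ _
  have h₂ : i' ≫ p' = 0 := hP.inr_desc _ _ _
  have : Epi p' := epi_of_epi_fac h₁
  refine ⟨p', hE.conf_of_cokernel hi' h₂ fun g hg => ?_, h₁⟩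
  obtain ⟨k, hk⟩ := hE.desc h (f' ≫ g) (by rw [hP.w_assoc, hg, comp_zero])
  exact ⟨k, hP.hom_ext (by rw [reassoc_of% h₁, hk]) (by rw [reassoc_of% h₂, hg, zero_comp])⟩

/-- The pushout of a conflation along a morphism out of its first term. -/
lemma exists_pushout {X Y Z X' : C} {i : X ⟶ Y} {p : Y ⟶ Z} (h : Conf E i p) (f : X ⟶ X') :
    ∃ (Y' : C) (f' : Y ⟶ Y') (i' : X' ⟶ Y') (p' : Y' ⟶ Z),
      IsPushout i f f' i' ∧ Conf E i' p' ∧ f' ≫ p' = p := by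
  obtain ⟨Y', f', i', hP, -⟩ := hE.pushout i f h.admissibleMono
  obtain ⟨p', h₁, h₂⟩ := hE.exists_conf_of_isPushout h hP
  exact ⟨Y', f', i', p', hP, h₁, h₂⟩

/-- The pullback of a conflation along a morphism into its last term. -/
lemma exists_pullback {X Y Z Z' : C} {i : X ⟶ Y} {p : Y ⟶ Z} (h : Conf E i p) (f : Z' ⟶ Z) :
    ∃ (Y' : C) (f' : Y' ⟶ Y) (p' : Y' ⟶ Z') (i' : X ⟶ Y'),
      IsPullback f' p' p f ∧ Conf E i' p' ∧ i' ≫ f' = i := by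
  obtain ⟨Y', f', p', hP, hp'⟩ := hE.pullback p f h.admissibleEpi
  have := hE.mono h
  let i' : X ⟶ Y' := hP.lift i 0 (by simp [h.w])
  have h₁ : i' ≫ f' = i := hP.lift_fst _ _ _
  have h₂ : i' ≫ p' = 0 := hP.lift_snd _ _ _
  have : Mono i' := mono_of_mono_fac h₁
  refine ⟨Y', f', p', i', hP, hE.conf_of_kernel hp' h₂ fun g hg => ?_, h₁⟩
  obtain ⟨k, hk⟩ := hE.lift h (g ≫ f') (by rw [Category.assoc, hP.w, reassoc_of% hg, zero_comp])
  exact ⟨k, hP.hom_ext (by rw [Category.assoc, h₁, hk])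
    (by rw [Category.assoc, h₂, hg, comp_zero])⟩

/-- The third isomorphism theorem: a composite of two admissible monomorphisms. -/
lemma exists_noether {X Y Z Q R : C} {i : X ⟶ Y} {p : Y ⟶ Q} {j : Y ⟶ Z} {r : Z ⟶ R}
    (h : Conf E i p) (h' : Conf E j r) :
    ∃ (P : C) (f : Z ⟶ P) (k : Q ⟶ P) (s : P ⟶ R),
      Conf E (i ≫ j) f ∧ Conf E k s ∧ IsPushout j p f k ∧ f ≫ s = r := by
  obtain ⟨P, f, k, s, hP, hk, hs⟩ := hE.exists_pushout h' p
  have := hE.epi h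
  have hf : Epi f := ⟨fun a b hab => hP.hom_ext hab (by
    rw [← cancel_epi p, ← hP.w_assoc, ← hP.w_assoc, hab])⟩
  refine ⟨P, f, k, s, hE.conf_of_cokernel (hE.mono_comp _ _ h.admissibleMono h'.admissibleMono)
    (by rw [Category.assoc, hP.w, reassoc_of% h.w, zero_comp]) fun g hg => ?_, hk, hP, hs⟩
  obtain ⟨b, hb⟩ := hE.desc h (j ≫ g) (by simpa using hg)
  exact ⟨hP.desc g b hb.symm, hP.inl_desc _ _ _⟩

/-- The dual of the third isomorphism theorem: a composite of two admissible epimorphisms. -/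
lemma exists_noether_epi {K Y Z L V : C} {k : K ⟶ Y} {p : Y ⟶ Z} {l : L ⟶ Z} {q : Z ⟶ V}
    (h : Conf E k p) (h' : Conf E l q) :
    ∃ (M : C) (m : M ⟶ Y) (t : M ⟶ L) (s : K ⟶ M),
      Conf E m (p ≫ q) ∧ Conf E s t ∧ IsPullback m t p l ∧ s ≫ m = k := by
  obtain ⟨M, m, t, s, hP, hk, hs⟩ := hE.exists_pullback h l
  have := hE.mono h'
  have hm : Mono m := ⟨fun a b hab => hP.hom_ext hab (by
    rw [← cancel_mono l, Category.assoc, Category.assoc, ← hP.w, reassoc_of% hab])⟩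
  refine ⟨M, m, t, s, hE.conf_of_kernel (hE.epi_comp _ _ h.admissibleEpi h'.admissibleEpi)
    (by rw [hP.w_assoc, h'.w, comp_zero]) fun g hg => ?_, hk, hP, hs⟩
  obtain ⟨b, hb⟩ := hE.lift h' (g ≫ p) (by simpa using hg)
  exact ⟨hP.lift g b hb.symm, hP.lift_fst _ _ _⟩

section Biprod

variable [HasBinaryBiproducts C]

lemma conf_inl_snd (X Y : C) : Conf E (biprod.inl : X ⟶ X ⊞ Y) biprod.snd :=
  hE.conf_of_splitting (by simp) ⟨biprod.fst, biprod.inr, by simp, by simp, by simp⟩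

lemma conf_inr_fst (X Y : C) : Conf E (biprod.inr : Y ⟶ X ⊞ Y) biprod.fst :=
  hE.conf_of_splitting (by simp) ⟨biprod.snd, biprod.inl, by simp, by simp, by simp [add_comm]⟩

/-- The map in question is the pushout of `i` along `biprod.inl`. -/
lemma admissibleMono_biprod_map {X Y : C} {i : X ⟶ Y} (hi : AdmissibleMono E i) (Z : C) :
    AdmissibleMono E (biprod.map i (𝟙 Z)) := by
  obtain ⟨Y', f', i', hP, hi'⟩ := hE.pushout i (biprod.inl : X ⟶ X ⊞ Z) hi
  have hQ : IsPushout i (biprod.inl : X ⟶ X ⊞ Z) biprod.inl (biprod.map i (𝟙 Z)) :=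
    IsPushout.of_isColimit' ⟨by simp⟩ (PushoutCocone.IsColimit.mk _
      (fun s => biprod.desc s.inl (biprod.inr ≫ s.inr)) (fun s => by simp)
      (fun s => by
        ext
        · simpa using s.condition
        · simp)
      (fun s m h₁ h₂ => by
        ext
        · simpa using h₁
        · simp [← h₂]))
  have := hE.mono_comp _ _ hi' (hE.admissibleMono_of_isIso (hP.isoIsPushout _ _ hQ).hom)
  simpa using this

lemma admissibleEpi_biprod_map {X Y : C} {p : X ⟶ Y} (hp : AdmissibleEpi E p) (Z : C) :
    AdmissibleEpi E (biprod.map p (𝟙 Z)) := by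
  obtain ⟨Y', f', p', hP, hp'⟩ := hE.pullback p (biprod.fst : Y ⊞ Z ⟶ Y) hp
  have hQ : IsPullback biprod.fst (biprod.map p (𝟙 Z)) p (biprod.fst : Y ⊞ Z ⟶ Y) :=
    IsPullback.of_isLimit' ⟨by simp⟩ (PullbackCone.IsLimit.mk _
      (fun s => biprod.lift s.fst (s.snd ≫ biprod.snd)) (fun s => by simp)
      (fun s => by
        ext
        · simpa using s.condition
        · simp)
      (fun s m h₁ h₂ => by
        ext
        · simpa using h₁
        · simp [← h₂]))
  have := hE.epi_comp _ _ (hE.admissibleEpi_of_isIso (hP.isoIsPullback _ _ hQ).inv) hp'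
  simpa using this

/-- A pushout square along an admissible monomorphism gives a conflation. -/
lemma conf_of_isPushout {X Y X' Y' : C} {i : X ⟶ Y} {f : X ⟶ X'} {f' : Y ⟶ Y'} {i' : X' ⟶ Y'}
    (hi : AdmissibleMono E i) (hP : IsPushout i f f' i') :
    Conf E (biprod.lift i f) (biprod.desc f' (-i')) := by
  have : Epi (biprod.desc f' (-i')) := ⟨fun a b hab => hP.hom_ext
    (by simpa using biprod.inl ≫= hab) (by simpa using biprod.inr ≫= hab)⟩
  refine hE.conf_of_cokernel ?_ (by simp [hP.w]) fun g hg => ?_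
  -- The graph-like map `(i, f)` is the split inclusion of `X`, followed by the shear automorphism
  -- with entry `f`, followed by `i ⊞ 𝟙`; each factor is an admissible monomorphism.
  · have he : IsIso (biprod.desc (biprod.lift (𝟙 X) f) biprod.inr : X ⊞ X' ⟶ X ⊞ X') :=
      ⟨biprod.desc (biprod.lift (𝟙 X) (-f)) biprod.inr, by ext <;> simp, by ext <;> simp⟩
    have := hE.mono_comp _ _ (hE.mono_comp _ _ (hE.conf_inl_snd X X').admissibleMono
      (hE.admissibleMono_of_isIso (biprod.desc (biprod.lift (𝟙 X) f) biprod.inr)))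
      (hE.admissibleMono_biprod_map hi X')
    have h : (biprod.inl ≫ biprod.desc (biprod.lift (𝟙 X) f) biprod.inr) ≫
        biprod.map i (𝟙 X') = biprod.lift i f := by
      ext <;> simp
    rwa [h] at this
  · have : i ≫ biprod.inl ≫ g = f ≫ (-(biprod.inr ≫ g)) := by
      have h : biprod.lift i f = i ≫ biprod.inl + f ≫ biprod.inr := by ext <;> simp
      rw [h, Preadditive.add_comp, Category.assoc, Category.assoc] at hg
      rw [Preadditive.comp_neg]
      exact eq_neg_of_add_eq_zero_left hg
    exact ⟨hP.desc _ _ this, by ext <;> simp⟩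

/-- A pullback square along an admissible epimorphism gives a conflation. -/
lemma conf_of_isPullback {Y Z Y' Z' : C} {p : Y ⟶ Z} {f : Z' ⟶ Z} {f' : Y' ⟶ Y} {p' : Y' ⟶ Z'}
    (hp : AdmissibleEpi E p) (hP : IsPullback f' p' p f) :
    Conf E (biprod.lift f' p') (biprod.desc p (-f)) := by
  have : Mono (biprod.lift f' p') := ⟨fun a b hab => hP.hom_ext
    (by simpa using hab =≫ biprod.fst) (by simpa using hab =≫ biprod.snd)⟩
  refine hE.conf_of_kernel ?_ (by simp [hP.w]) fun g hg => ?_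
  · have he : IsIso (biprod.desc biprod.inl (biprod.lift (-f) (𝟙 Z')) : Z ⊞ Z' ⟶ Z ⊞ Z') :=
      ⟨biprod.desc biprod.inl (biprod.lift f (𝟙 Z')), by ext <;> simp, by ext <;> simp⟩
    have := hE.epi_comp _ _ (hE.admissibleEpi_biprod_map hp Z')
      (hE.epi_comp _ _ (hE.admissibleEpi_of_isIso
        (biprod.desc biprod.inl (biprod.lift (-f) (𝟙 Z')))) (hE.conf_inr_fst Z Z').admissibleEpi)
    have h : biprod.map p (𝟙 Z') ≫ biprod.desc biprod.inl (biprod.lift (-f) (𝟙 Z')) ≫ biprod.fst =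
        biprod.desc p (-f) := by
      ext <;> simp
    rwa [h] at this
  · have : (g ≫ biprod.fst) ≫ p = (g ≫ biprod.snd) ≫ f := by
      have h : biprod.desc p (-f) = biprod.fst ≫ p - biprod.snd ≫ f := by ext <;> simp
      rw [h, Preadditive.comp_sub, ← Category.assoc, ← Category.assoc] at hg
      exact sub_eq_zero.1 hg
    exact ⟨hP.lift _ _ this, by ext <;> simp⟩

end Biprod

end IsExactCategory

end Conflations

/-! ### Turning an autoequivalence into a shift by the integers -/

section Spectra

variable {D : Type u} [Category.{v} D]

/-- Recursion in both directions from `0`. The negative half starts at `-1`, one step below `t₀`;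
matching on the constructors of `ℤ` makes each index `n + 1` reduce definitionally. -/
lemma exists_int_sequence {T : ℤ → Type*} (r : ∀ n, T n → T (n + 1) → Prop)
    (h₁ : ∀ n x, ∃ y, r n x y) (h₂ : ∀ n y, ∃ x, r n x y) (t₀ : T 0) :
    ∃ t : ∀ n, T n, t 0 = t₀ ∧ ∀ n, r n (t n) (t (n + 1)) := by
  choose a ha using h₁
  choose b hb using h₂
  let up : ∀ k : ℕ, T (Int.ofNat k) := fun k => Nat.rec t₀ (fun k x => a (Int.ofNat k) x) k
  let down : ∀ k : ℕ, T (Int.negSucc k) :=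
    fun k => Nat.rec (b (Int.negSucc 0) t₀) (fun k x => b (Int.negSucc (k + 1)) x) k
  refine ⟨fun n => match n with
    | Int.ofNat k => up k
    | Int.negSucc k => down k, rfl, fun n => ?_⟩
  match n with
  | Int.ofNat k => exact ha _ _
  | Int.negSucc 0 => exact hb _ _
  | Int.negSucc (k + 1) => exact hb _ _

/-- A sequence of objects indexed by `ℤ`, each of which is identified with the image of the
previous one by the endofunctor `Φ`. -/
structure Spectrum (Φ : D ⥤ D) where
  X : ℤ → D
  ε : ∀ n m : ℤ, n + 1 = m → (Φ.obj (X n) ≅ X m)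

namespace Spectrum

variable {Φ : D ⥤ D}

/-- Morphisms of spectra. -/
@[ext]
structure Hom (X Y : Spectrum Φ) where
  f : ∀ n : ℤ, X.X n ⟶ Y.X n
  comm : ∀ (n m : ℤ) (h : n + 1 = m),
    Φ.map (f n) ≫ (Y.ε n m h).hom = (X.ε n m h).hom ≫ f m := by cat_disch

instance : Category (Spectrum Φ) where
  Hom := Hom
  id X := { f := fun n => 𝟙 _ }
  comp φ ψ :=
    { f := fun n => φ.f n ≫ ψ.f n
      comm := fun n m h => by
        rw [Φ.map_comp, Category.assoc, ψ.comm, reassoc_of% φ.comm n m h] }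

@[simp]
lemma id_f (X : Spectrum Φ) (n : ℤ) : Hom.f (𝟙 X) n = 𝟙 (X.X n) := rfl

@[simp]
lemma comp_f {X Y Z : Spectrum Φ} (φ : X ⟶ Y) (ψ : Y ⟶ Z) (n : ℤ) :
    (φ ≫ ψ).f n = φ.f n ≫ ψ.f n := rfl

@[ext]
lemma hom_ext {X Y : Spectrum Φ} {φ ψ : X ⟶ Y} (h : ∀ n, φ.f n = ψ.f n) : φ = ψ :=
  Hom.ext (funext h)

lemma eqToHom_f {X Y : Spectrum Φ} (h : X = Y) (n : ℤ) :
    (eqToHom h : X ⟶ Y).f n = eqToHom (by rw [h]) := by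
  subst h
  rfl

lemma map_eqToHom_ε (X : Spectrum Φ) {n n' m m' : ℤ} (hn : n = n') (hm : m = m')
    (h : n + 1 = m) (h' : n' + 1 = m') :
    Φ.map (eqToHom (by rw [hn] : X.X n = X.X n')) ≫ (X.ε n' m' h').hom =
      (X.ε n m h).hom ≫ eqToHom (by rw [hm]) := by
  subst hn hm
  simp

/-- Reindexing of spectra. -/
@[simps]
def shift (a : ℤ) : Spectrum Φ ⥤ Spectrum Φ where
  obj X :=
    { X := fun n => X.X (n + a)
      ε := fun n m h => X.ε (n + a) (m + a) (by lia) }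
  map φ :=
    { f := fun n => φ.f (n + a)
      comm := fun n m h => φ.comm _ _ _ }

lemma f_eqToHom {X Y : Spectrum Φ} (φ : X ⟶ Y) {n m : ℤ} (h : n = m) :
    φ.f n ≫ eqToHom (by rw [h]) = eqToHom (by rw [h]) ≫ φ.f m := by
  subst h
  simp

noncomputable instance : HasShift (Spectrum Φ) ℤ :=
  hasShiftMk _ _
    { F := shift
      zero := NatIso.ofComponents (fun X =>
        { hom := { f := fun n => eqToHom (by simp)
                   comm := fun n m h => X.map_eqToHom_ε (by simp) (by simp) _ _ }
          inv := { f := fun n => eqToHom (by simp)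
                   comm := fun n m h => X.map_eqToHom_ε (by simp) (by simp) _ _ } })
        (fun φ => by
          ext n
          exact f_eqToHom φ (by simp))
      add := fun a b => NatIso.ofComponents (fun X =>
        { hom := { f := fun n => eqToHom (congrArg X.X (by lia))
                   comm := fun n m h => X.map_eqToHom_ε (by lia) (by lia) _ _ }
          inv := { f := fun n => eqToHom (congrArg X.X (by lia))
                   comm := fun n m h => X.map_eqToHom_ε (by lia) (by lia) _ _ }
          hom_inv_id := by
            ext n
            rw [comp_f]
            erw [eqToHom_trans]
            exacts [rfl, congrArg X.X (by lia), congrArg X.X (by lia)]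
          inv_hom_id := by
            ext n
            rw [comp_f]
            erw [eqToHom_trans]
            exacts [rfl, congrArg X.X (by lia), congrArg X.X (by lia)] })
        (fun φ => by
          ext n
          exact f_eqToHom φ (by lia))
      assoc_hom_app := fun a b c X => by
        ext n
        simp only [eqToHom_f, NatIso.ofComponents_hom_app, comp_f, shift_map_f]
        erw [eqToHom_trans, eqToHom_trans, eqToHom_trans]
      zero_add_hom_app := fun a X => by
        ext n
        simp only [eqToHom_f, NatIso.ofComponents_hom_app, NatIso.ofComponents_inv_app,
          comp_f, shift_map_f]
        exact (eqToHom_trans _ _).symm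
      add_zero_hom_app := fun a X => by
        ext n
        simp [eqToHom_f] }

variable (Φ) in
/-- The evaluation of spectra. -/
@[simps]
def eval : Spectrum Φ ⥤ D where
  obj X := X.X 0
  map φ := φ.f 0

/-- Component `0` determines the rest: upwards by the structure isomorphisms, downwards because `Φ`
can be cancelled. Fullness and essential surjectivity below use the same two directions to extend
data given at `0`. -/
lemma eval_faithful [Φ.Faithful] : (eval Φ).Faithful where
  map_injective {X Y φ ψ} h := by
    ext n
    induction n using Int.induction_on with
    | zero => exact h
    | succ n ih =>
      rw [← cancel_epi (X.ε n _ rfl).hom, ← φ.comm, ← ψ.comm, ih]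
    | pred n ih =>
      apply Φ.map_injective
      rw [← cancel_mono (Y.ε (-(n : ℤ) - 1) (-(n : ℤ)) (by lia)).hom, φ.comm, ψ.comm, ih]

lemma eval_full [Φ.Full] : (eval Φ).Full where
  map_surjective {X Y} g := by
    obtain ⟨f, hf₀, hf⟩ := exists_int_sequence (T := fun n => X.X n ⟶ Y.X n)
      (fun n x y => Φ.map x ≫ (Y.ε n _ rfl).hom = (X.ε n _ rfl).hom ≫ y)
      (fun n x => ⟨(X.ε n _ rfl).inv ≫ Φ.map x ≫ (Y.ε n _ rfl).hom, by simp⟩)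
      (fun n y => ⟨Φ.preimage ((X.ε n _ rfl).hom ≫ y ≫ (Y.ε n _ rfl).inv), by simp⟩) g
    exact ⟨{ f := f, comm := by rintro n _ rfl; exact hf n }, hf₀⟩

lemma eval_essSurj [Φ.EssSurj] : (eval Φ).EssSurj where
  mem_essImage Z := by
    obtain ⟨X, hX₀, hX⟩ := exists_int_sequence (T := fun _ => D)
      (fun _ x y => Nonempty (Φ.obj x ≅ y)) (fun n x => ⟨_, ⟨Iso.refl _⟩⟩)
      (fun n y => ⟨_, ⟨Φ.objObjPreimageIso y⟩⟩) Z
    exact ⟨{ X := X, ε := by rintro n _ rfl; exact (hX n).some }, ⟨eqToIso hX₀⟩⟩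

end Spectrum

/-- An autoequivalence of a category is the shift by `1` for a suitable shift by integers. -/
theorem exists_hasShift (Φ : D ⥤ D) [Φ.IsEquivalence] :
    ∃ _ : HasShift D ℤ, Nonempty (Φ ≅ shiftFunctor D (1 : ℤ)) := by
  have := Spectrum.eval_faithful (Φ := Φ)
  have := Spectrum.eval_full (Φ := Φ)
  have := Spectrum.eval_essSurj (Φ := Φ)
  have : (Spectrum.eval Φ).IsEquivalence := { }
  let e := (Spectrum.eval Φ).asEquivalence
  let s : ℤ → D ⥤ D := fun n => e.inverse ⋙ shiftFunctor (Spectrum Φ) n ⋙ e.functor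
  let i : ∀ n, s n ⋙ e.inverse ≅ e.inverse ⋙ shiftFunctor (Spectrum Φ) n := fun n =>
    Functor.associator _ _ _ ≪≫ Functor.isoWhiskerLeft _ (Functor.associator _ _ _ ≪≫
      Functor.isoWhiskerLeft _ e.unitIso.symm ≪≫ Functor.rightUnitor _)
  refine ⟨e.fullyFaithfulInverse.hasShift s i, ⟨?_⟩⟩
  -- Under evaluation at `0`, reindexing by `1` becomes `Φ` through the structure isomorphism from
  -- index `0` to index `1`.
  let j : e.functor ⋙ Φ ≅ Spectrum.shift 1 ⋙ e.functor :=
    NatIso.ofComponents (fun X => X.ε 0 (0 + 1) rfl) (fun φ => φ.comm _ _ _)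
  exact (Functor.leftUnitor _).symm ≪≫ Functor.isoWhiskerRight e.counitIso.symm Φ ≪≫
    Functor.associator _ _ _ ≪≫ Functor.isoWhiskerLeft _ j

end Spectra

/-! ### The suspension and the connecting morphisms of a stable category -/

section Suspension

variable {B : Type u} [Category.{v} B] [Preadditive B] {E : ObjectProperty (ShortComplex B)}
  {D : Type u₂} [Category.{v₂} D] [Preadditive D]

/-- The functor `π` identifies `D` with the quotient of `B` by the morphisms which factor through
injective objects, up to equivalence. -/
structure IsStableQuotient (E : ObjectProperty (ShortComplex B)) (π : B ⥤ D) : Prop where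
  additive : π.Additive
  full : π.Full
  essSurj : π.EssSurj
  map_eq_zero_iff : ∀ {X Y : B} (f : X ⟶ Y),
    π.map f = 0 ↔ ∃ (I : B) (a : X ⟶ I) (b : I ⟶ Y), IsInjective E I ∧ a ≫ b = f

lemma conf_of_mem {S : ShortComplex B} (hS : E S) : Conf E S.f S.g := ⟨S.zero, hS⟩

lemma IsStableQuotient.map_eq_iff {π : B ⥤ D} (hπ : IsStableQuotient E π) {X Y : B}
    (f g : X ⟶ Y) :
    π.map f = π.map g ↔ ∃ (I : B) (a : X ⟶ I) (b : I ⟶ Y), IsInjective E I ∧ a ≫ b = f - g := by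
  have := hπ.additive
  rw [← sub_eq_zero, ← π.map_sub, hπ.map_eq_zero_iff]

lemma IsExactCategory.exists_hom_of_injective (hE : IsExactCategory E) {S S' : ShortComplex B}
    (hS : E S) (hI : IsInjective E S'.X₂) (f : S.X₁ ⟶ S'.X₁) : ∃ φ : S ⟶ S', φ.τ₁ = f := by
  have hc := conf_of_mem hS
  obtain ⟨e, he⟩ := hI S.f (f ≫ S'.f) hc.admissibleMono
  obtain ⟨c, hc⟩ := hE.desc hc (e ≫ S'.g) (by rw [reassoc_of% he, S'.zero, comp_zero])
  exact ⟨{ τ₁ := f, τ₂ := e, τ₃ := c, comm₁₂ := he.symm, comm₂₃ := hc.symm }, rfl⟩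

lemma IsExactCategory.exists_hom_of_projective (hE : IsExactCategory E) {S S' : ShortComplex B}
    (hS' : E S') (hI : IsProjective E S.X₂) (f : S.X₃ ⟶ S'.X₃) : ∃ φ : S ⟶ S', φ.τ₃ = f := by
  have hc := conf_of_mem hS'
  obtain ⟨e, he⟩ := hI S'.g (S.g ≫ f) hc.admissibleEpi
  obtain ⟨c, hc⟩ := hE.lift hc (S.f ≫ e) (by rw [Category.assoc, he, S.zero_assoc, zero_comp])
  exact ⟨{ τ₁ := c, τ₂ := e, τ₃ := f, comm₁₂ := hc, comm₂₃ := he }, rfl⟩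

/-- If the first components differ by `a ≫ b` through an injective, extend `a` to the middle term
and subtract the resulting map from the difference of the middle components. What remains kills
`S.f`, so it descends to `S.X₃`; hence the last components differ by a map through the injective
`S'.X₂`. -/
lemma IsStableQuotient.map_τ₃_eq (hE : IsExactCategory E) {π : B ⥤ D}
    (hπ : IsStableQuotient E π) {S S' : ShortComplex B} (hS : E S)
    (hI : IsInjective E S'.X₂) (φ ψ : S ⟶ S') (h : π.map φ.τ₁ = π.map ψ.τ₁) :
    π.map φ.τ₃ = π.map ψ.τ₃ := by
  obtain ⟨I, a, b, hI', hab⟩ := (hπ.map_eq_iff _ _).1 h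
  have hc := conf_of_mem hS
  have := hE.epi hc
  obtain ⟨a', ha'⟩ := hI' S.f a hc.admissibleMono
  obtain ⟨t, ht⟩ := hE.desc hc (φ.τ₂ - ψ.τ₂ - a' ≫ b ≫ S'.f) (by
    rw [Preadditive.comp_sub, Preadditive.comp_sub, ← φ.comm₁₂, ← ψ.comm₁₂, reassoc_of% ha',
      reassoc_of% hab, Preadditive.sub_comp, sub_self])
  refine (hπ.map_eq_iff _ _).2 ⟨S'.X₂, t, S'.g, hI, ?_⟩
  rw [← cancel_epi S.g, reassoc_of% ht]
  simp [φ.comm₂₃, ψ.comm₂₃]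

/-- The dual of `map_τ₃_eq`, which needs injectives to be projective. It is what makes the
suspension faithful. -/
lemma IsStableQuotient.map_τ₁_eq (hE : IsFrobenius E) {π : B ⥤ D}
    (hπ : IsStableQuotient E π) {S S' : ShortComplex B} (hS' : E S')
    (hI : IsInjective E S.X₂) (φ ψ : S ⟶ S') (h : π.map φ.τ₃ = π.map ψ.τ₃) :
    π.map φ.τ₁ = π.map ψ.τ₁ := by
  obtain ⟨I, a, b, hI', hab⟩ := (hπ.map_eq_iff _ _).1 h
  have hc := conf_of_mem hS'
  have := hE.exact.mono hc
  obtain ⟨b', hb'⟩ := (hE.projective_iff_injective I).2 hI' S'.g b hc.admissibleEpi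
  obtain ⟨t, ht⟩ := hE.exact.lift hc (φ.τ₂ - ψ.τ₂ - S.g ≫ a ≫ b') (by
    simp [hb', hab, φ.comm₂₃, ψ.comm₂₃])
  refine (hπ.map_eq_iff _ _).2 ⟨S.X₂, S.f, t, hI, ?_⟩
  rw [← cancel_mono S'.f, Category.assoc, ht]
  simp [φ.comm₁₂, ψ.comm₁₂]

section suspMap

variable (hE : IsExactCategory E) {π : B ⥤ D} (hπ : IsStableQuotient E π)

include hE hπ in
lemma exists_suspMap {S S' : ShortComplex B} (hS : E S) (hI : IsInjective E S'.X₂)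
    (h : π.obj S.X₁ ⟶ π.obj S'.X₁) :
    ∃ φ : S ⟶ S', π.map φ.τ₁ = h := by
  have := hπ.full
  obtain ⟨φ, hφ⟩ := hE.exists_hom_of_injective hS hI (π.preimage h)
  exact ⟨φ, by rw [hφ, π.map_preimage]⟩

/-- The morphism on the last terms induced by a morphism in the quotient between the first terms
of two conflations, when the middle term of the target is injective. -/
noncomputable def suspMap {S S' : ShortComplex B} (hS : E S) (hI : IsInjective E S'.X₂)
    (h : π.obj S.X₁ ⟶ π.obj S'.X₁) : π.obj S.X₃ ⟶ π.obj S'.X₃ :=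
  π.map (exists_suspMap hE hπ hS hI h).choose.τ₃

lemma map_τ₃_eq_suspMap {S S' : ShortComplex B} (hS : E S) (hI : IsInjective E S'.X₂)
    {h : π.obj S.X₁ ⟶ π.obj S'.X₁} (φ : S ⟶ S') (hφ : π.map φ.τ₁ = h) :
    π.map φ.τ₃ = suspMap hE hπ hS hI h :=
  hπ.map_τ₃_eq hE hS hI _ _ (by rw [hφ, (exists_suspMap hE hπ hS hI h).choose_spec])

lemma suspMap_id {S : ShortComplex B} (hS : E S) (hI : IsInjective E S.X₂) :
    suspMap hE hπ hS hI (𝟙 (π.obj S.X₁)) = 𝟙 _ := by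
  rw [← map_τ₃_eq_suspMap hE hπ hS hI (𝟙 S) (by simp)]
  simp

lemma suspMap_comp {S S' S'' : ShortComplex B} (hS : E S) (hS' : E S')
    (hI' : IsInjective E S'.X₂) (hI'' : IsInjective E S''.X₂)
    (h : π.obj S.X₁ ⟶ π.obj S'.X₁) (h' : π.obj S'.X₁ ⟶ π.obj S''.X₁) :
    suspMap hE hπ hS hI' h ≫ suspMap hE hπ hS' hI'' h' = suspMap hE hπ hS hI'' (h ≫ h') := by
  obtain ⟨φ, hφ⟩ := exists_suspMap hE hπ hS hI' h
  obtain ⟨ψ, hψ⟩ := exists_suspMap hE hπ hS' hI'' h'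
  rw [← map_τ₃_eq_suspMap hE hπ hS hI' φ hφ, ← map_τ₃_eq_suspMap hE hπ hS' hI'' ψ hψ,
    ← map_τ₃_eq_suspMap hE hπ hS hI'' (φ ≫ ψ) (by simp [hφ, hψ])]
  simp

lemma suspMap_add {S S' : ShortComplex B} (hS : E S) (hI : IsInjective E S'.X₂)
    (h h' : π.obj S.X₁ ⟶ π.obj S'.X₁) :
    suspMap hE hπ hS hI (h + h') = suspMap hE hπ hS hI h + suspMap hE hπ hS hI h' := by
  have := hπ.additive
  obtain ⟨φ, hφ⟩ := exists_suspMap hE hπ hS hI h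
  obtain ⟨ψ, hψ⟩ := exists_suspMap hE hπ hS hI h'
  rw [← map_τ₃_eq_suspMap hE hπ hS hI φ hφ, ← map_τ₃_eq_suspMap hE hπ hS hI ψ hψ,
    ← map_τ₃_eq_suspMap hE hπ hS hI (φ + ψ) (by simp [hφ, hψ])]
  simp

lemma suspMap_comp_map {S S' S'' : ShortComplex B} (hS : E S) (hS' : E S')
    (hI'' : IsInjective E S''.X₂) (φ : S ⟶ S') (h' : π.obj S'.X₁ ⟶ π.obj S''.X₁) :
    π.map φ.τ₃ ≫ suspMap hE hπ hS' hI'' h' = suspMap hE hπ hS hI'' (π.map φ.τ₁ ≫ h') := by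
  obtain ⟨ψ, hψ⟩ := exists_suspMap hE hπ hS' hI'' h'
  rw [← map_τ₃_eq_suspMap hE hπ hS' hI'' ψ hψ,
    ← map_τ₃_eq_suspMap hE hπ hS hI'' (φ ≫ ψ) (by simp [hψ])]
  simp

end suspMap

/-- The suspension on a stable category: an autoequivalence, together with a connecting morphism
for each conflation, which is invertible when the middle term is injective. -/
theorem exists_suspension (hE : IsFrobenius E) {π : B ⥤ D} (hπ : IsStableQuotient E π) :
    ∃ (Φ : D ⥤ D) (_ : Φ.IsEquivalence) (_ : Φ.Additive)
      (δ : ∀ S : ShortComplex B, E S → (π.obj S.X₃ ⟶ Φ.obj (π.obj S.X₁))),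
      (∀ (S S' : ShortComplex B) (hS : E S) (hS' : E S') (φ : S ⟶ S'),
        π.map φ.τ₃ ≫ δ S' hS' = δ S hS ≫ Φ.map (π.map φ.τ₁)) ∧
      ∀ (S : ShortComplex B) (hS : E S), IsInjective E S.X₂ → IsIso (δ S hS) := by
  have hE' := hE.exact
  have := hπ.full
  have := hπ.essSurj
  -- Since `π` is only essentially surjective, the chosen conflation starts at a preimage of `X`,
  -- and the comparison `o X` enters every formula.
  have inj : ∀ X : D, ∃ S : ShortComplex B, E S ∧ IsInjective E S.X₂ ∧
      Nonempty (π.obj S.X₁ ≅ X) := fun X => by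
    obtain ⟨I, i, hI, Z, p, w, h⟩ := hE.enoughInjectives (π.objPreimage X)
    exact ⟨_, h, hI, ⟨π.objObjPreimageIso X⟩⟩
  choose J hJ hI o' using inj
  let o : ∀ X, π.obj (J X).X₁ ≅ X := fun X => (o' X).some
  let Φ : D ⥤ D :=
    { obj := fun X => π.obj (J X).X₃
      map := fun {X Y} f => suspMap hE' hπ (hJ X) (hI Y) ((o X).hom ≫ f ≫ (o Y).inv)
      map_id := fun X => by
        rw [Category.id_comp, Iso.hom_inv_id, suspMap_id hE' hπ (hJ X) (hI X)]
      map_comp := fun {X Y Z} f g => by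
        rw [suspMap_comp hE' hπ]
        simp }
  -- The connecting morphism compares `S` with the chosen conflation; only the target needs an
  -- injective middle term, so it exists for every `S`.
  let δ : ∀ S : ShortComplex B, E S → (π.obj S.X₃ ⟶ Φ.obj (π.obj S.X₁)) := fun S hS =>
    suspMap hE' hπ hS (hI _) (o (π.obj S.X₁)).inv
  have hδ : ∀ (S : ShortComplex B) (hS : E S), IsInjective E S.X₂ → IsIso (δ S hS) := by
    intro S hS hSI
    refine ⟨suspMap hE' hπ (hJ _) hSI (o (π.obj S.X₁)).hom, ?_, ?_⟩
    · rw [suspMap_comp hE' hπ, Iso.inv_hom_id, suspMap_id]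
    · rw [suspMap_comp hE' hπ, Iso.hom_inv_id, suspMap_id]
  have : Φ.Faithful := ⟨fun {X Y f g} h => by
    obtain ⟨φ, hφ⟩ := exists_suspMap hE' hπ (hJ X) (hI Y) ((o X).hom ≫ f ≫ (o Y).inv)
    obtain ⟨ψ, hψ⟩ := exists_suspMap hE' hπ (hJ X) (hI Y) ((o X).hom ≫ g ≫ (o Y).inv)
    dsimp only [Φ] at h
    rw [← map_τ₃_eq_suspMap hE' hπ _ _ φ hφ, ← map_τ₃_eq_suspMap hE' hπ _ _ ψ hψ] at h
    have := hπ.map_τ₁_eq hE (hJ Y) (hI X) _ _ h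
    rw [hφ, hψ] at this
    simpa using this⟩
  have : Φ.Full := ⟨fun {X Y} g => by
    obtain ⟨φ, hφ⟩ := hE'.exists_hom_of_projective (S := J X) (S' := J Y) (hJ Y)
      ((hE.projective_iff_injective _).2 (hI X)) (π.preimage g)
    refine ⟨(o X).inv ≫ π.map φ.τ₁ ≫ (o Y).hom, ?_⟩
    dsimp only [Φ]
    rw [← map_τ₃_eq_suspMap hE' hπ (hJ X) (hI Y) φ (by simp), hφ, π.map_preimage]⟩
  -- For a projective cover of `Y` the middle term is also injective, so `δ` identifies `Y` with the
  -- suspension of the kernel.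
  have : Φ.EssSurj := ⟨fun Y => by
    obtain ⟨P, p, hP, K, k, w, h⟩ := hE.enoughProjectives (π.objPreimage Y)
    have := hδ _ h ((hE.projective_iff_injective _).1 hP)
    exact ⟨_, ⟨(asIso (δ _ h)).symm ≪≫ π.objObjPreimageIso Y⟩⟩⟩
  refine ⟨Φ, { }, ⟨fun {X Y f g} => ?_⟩, δ, fun S S' hS hS' φ => ?_, hδ⟩
  · dsimp only [Φ]
    rw [← suspMap_add hE' hπ, Preadditive.add_comp, Preadditive.comp_add]
  · dsimp only [Φ, δ]
    rw [suspMap_comp_map hE' hπ hS, suspMap_comp hE' hπ hS]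
    simp

/-- The suspension on a stable category, as a shift by integers. -/
theorem exists_shift_and_connecting (hE : IsFrobenius E) {π : B ⥤ D}
    (hπ : IsStableQuotient E π) :
    ∃ (_ : HasShift D ℤ) (_ : ∀ n : ℤ, (shiftFunctor D n).Additive)
      (δ : ∀ S : ShortComplex B, E S → (π.obj S.X₃ ⟶ (π.obj S.X₁)⟦(1 : ℤ)⟧)),
      (∀ (S S' : ShortComplex B) (hS : E S) (hS' : E S') (φ : S ⟶ S'),
        π.map φ.τ₃ ≫ δ S' hS' = δ S hS ≫ (π.map φ.τ₁)⟦(1 : ℤ)⟧') ∧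
      ∀ (S : ShortComplex B) (hS : E S), IsInjective E S.X₂ → IsIso (δ S hS) := by
  obtain ⟨Φ, _, _, δ, h₁, h₂⟩ := exists_suspension hE hπ
  obtain ⟨_, ⟨e⟩⟩ := exists_hasShift Φ
  have a₁ : (shiftFunctor D (1 : ℤ)).Additive := Functor.additive_of_iso e
  have : (shiftEquiv D (1 : ℤ)).functor.Additive := a₁
  have a₂ : (shiftFunctor D (-1 : ℤ)).Additive :=
    (shiftEquiv D (1 : ℤ)).inverse_additive
  refine ⟨inferInstance, fun n => ?_, fun S hS => δ S hS ≫ e.hom.app _, fun S S' hS hS' φ => ?_,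
    fun S hS hI => ?_⟩
  · induction n using Int.induction_on with
    | zero => exact Functor.additive_of_iso (shiftFunctorZero D ℤ).symm
    | succ n ih => exact Functor.additive_of_iso (shiftFunctorAdd D (n : ℤ) 1).symm
    | pred n ih =>
      exact Functor.additive_of_iso (shiftFunctorAdd' D (-(n : ℤ)) (-1) _ (by lia)).symm
  · rw [reassoc_of% h₁ S S' hS hS' φ, Category.assoc, e.hom.naturality]
  · have := h₂ S hS hI
    infer_instance

end Suspension

/-! ### The axioms of a triangulated category for the stable category -/

section StableTriangulation

variable {B : Type u} [Category.{v} B] [Preadditive B] {E : ObjectProperty (ShortComplex B)}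
  {D : Type u₂} [Category.{v₂} D] [Preadditive D]

lemma IsStableQuotient.isIso_map_snd {π : B ⥤ D} (hπ : IsStableQuotient E π)
    [HasBinaryBiproducts B] {I : B} (hI : IsInjective E I) (X : B) :
    IsIso (π.map (biprod.snd : I ⊞ X ⟶ X)) := by
  have := hπ.additive
  refine ⟨π.map biprod.inr, ?_, by simp [← π.map_comp]⟩
  have h : π.map (biprod.fst ≫ biprod.inl : I ⊞ X ⟶ I ⊞ X) = 0 :=
    (hπ.map_eq_zero_iff _).2 ⟨I, _, _, hI, rfl⟩
  rw [← π.map_comp, ← π.map_id, ← biprod.total, π.map_add, h, zero_add]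

/-- A morphism of the stable category is represented by an admissible monomorphism. -/
lemma IsStableQuotient.exists_admissibleMono (hE : IsFrobenius E) {π : B ⥤ D}
    (hπ : IsStableQuotient E π) {X Y : D} (f : X ⟶ Y) {X' : B} (e : X ≅ π.obj X') :
    ∃ (Y' : B) (j : X' ⟶ Y') (e' : Y ≅ π.obj Y'), AdmissibleMono E j ∧
      f ≫ e'.hom = e.hom ≫ π.map j := by
  have := hπ.full
  have := hπ.essSurj
  have := hE.exact.hasBinaryBiproducts
  let o := π.objObjPreimageIso Y
  obtain ⟨g, hg⟩ := π.map_surjective (e.inv ≫ f ≫ o.inv)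
  obtain ⟨I, i, hI, hi⟩ := hE.enoughInjectives X'
  obtain ⟨Q, f', i', hP, -⟩ := hE.exact.pushout i g hi
  have := hπ.isIso_map_snd hI (π.objPreimage Y)
  -- Adding the injective `I` to the target changes nothing in the stable category and makes the
  -- representative an admissible monomorphism.
  refine ⟨I ⊞ π.objPreimage Y, biprod.lift i g,
    o.symm ≪≫ (asIso (π.map (biprod.snd : I ⊞ π.objPreimage Y ⟶ _))).symm,
    (hE.exact.conf_of_isPushout hi hP).admissibleMono, ?_⟩
  rw [← cancel_mono (π.map (biprod.snd : I ⊞ π.objPreimage Y ⟶ _)), Category.assoc, Category.assoc,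
    ← π.map_comp, biprod.lift_snd, hg]
  simp

variable [HasShift D ℤ] {π : B ⥤ D}

/-- Constructor for isomorphisms between triangles given by their morphisms. -/
def triangleMkIso {X Y Z X' Y' Z' : D} {f : X ⟶ Y} {g : Y ⟶ Z} {h : Z ⟶ X⟦(1 : ℤ)⟧}
    {f' : X' ⟶ Y'} {g' : Y' ⟶ Z'} {h' : Z' ⟶ X'⟦(1 : ℤ)⟧} (e₁ : X ≅ X') (e₂ : Y ≅ Y')
    (e₃ : Z ≅ Z') (h₁ : f ≫ e₂.hom = e₁.hom ≫ f') (h₂ : g ≫ e₃.hom = e₂.hom ≫ g')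
    (h₃ : h ≫ e₁.hom⟦(1 : ℤ)⟧' = e₃.hom ≫ h') : Triangle.mk f g h ≅ Triangle.mk f' g' h' :=
  Triangle.isoMk _ _ e₁ e₂ e₃ h₁ h₂ h₃

variable
  (δ : ∀ S : ShortComplex B, E S → (π.obj S.X₃ ⟶ (π.obj S.X₁)⟦(1 : ℤ)⟧))

/-- The triangles isomorphic to those attached to conflations. -/
def stableDistTriang : Set (Triangle D) :=
  {T | ∃ (S : ShortComplex B) (hS : E S) (e₁ : T.obj₁ ≅ π.obj S.X₁) (e₂ : T.obj₂ ≅ π.obj S.X₂)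
    (e₃ : T.obj₃ ≅ π.obj S.X₃), T.mor₁ ≫ e₂.hom = e₁.hom ≫ π.map S.f ∧
      T.mor₂ ≫ e₃.hom = e₂.hom ≫ π.map S.g ∧
      T.mor₃ ≫ e₁.hom⟦(1 : ℤ)⟧' = e₃.hom ≫ δ S hS}

omit [Preadditive D] in
lemma mk_mem_stableDistTriang {X Y Z : D} {f : X ⟶ Y} {g : Y ⟶ Z} {h : Z ⟶ X⟦(1 : ℤ)⟧}
    (S : ShortComplex B) (hS : E S) (e₁ : X ≅ π.obj S.X₁) (e₂ : Y ≅ π.obj S.X₂)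
    (e₃ : Z ≅ π.obj S.X₃) (h₁ : f ≫ e₂.hom = e₁.hom ≫ π.map S.f)
    (h₂ : g ≫ e₃.hom = e₂.hom ≫ π.map S.g) (h₃ : h ≫ e₁.hom⟦(1 : ℤ)⟧' = e₃.hom ≫ δ S hS) :
    Triangle.mk f g h ∈ stableDistTriang δ :=
  ⟨S, hS, e₁, e₂, e₃, h₁, h₂, h₃⟩

omit [Preadditive D] in
lemma mem_stableDistTriang_of_mem (S : ShortComplex B) (hS : E S) :
    Triangle.mk (π.map S.f) (π.map S.g) (δ S hS) ∈ stableDistTriang δ :=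
  mk_mem_stableDistTriang δ S hS (Iso.refl _) (Iso.refl _) (Iso.refl _) (by simp) (by simp)
    (by simp)

omit [Preadditive D] in
lemma mem_stableDistTriang_of_iso {T T' : Triangle D} (h : T' ∈ stableDistTriang δ)
    (e : T ≅ T') : T ∈ stableDistTriang δ := by
  obtain ⟨S, hS, e₁, e₂, e₃, h₁, h₂, h₃⟩ := h
  let u₁ : T.obj₁ ≅ T'.obj₁ := ⟨e.hom.hom₁, e.inv.hom₁, by simp, by simp⟩
  let u₂ : T.obj₂ ≅ T'.obj₂ := ⟨e.hom.hom₂, e.inv.hom₂, by simp, by simp⟩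
  let u₃ : T.obj₃ ≅ T'.obj₃ := ⟨e.hom.hom₃, e.inv.hom₃, by simp, by simp⟩
  refine ⟨S, hS, u₁ ≪≫ e₁, u₂ ≪≫ e₂, u₃ ≪≫ e₃, ?_, ?_, ?_⟩ <;>
    simp [u₁, u₂, u₃, h₁, h₂, h₃]

omit [Preadditive D] in
lemma mem_stableDistTriang_iff (T : Triangle D) :
    T ∈ stableDistTriang δ ↔ ∃ (S : ShortComplex B) (hS : E S),
      Nonempty (T ≅ Triangle.mk (π.map S.f) (π.map S.g) (δ S hS)) := by
  refine ⟨?_, ?_⟩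
  · rintro ⟨S, hS, e₁, e₂, e₃, h₁, h₂, h₃⟩
    exact ⟨S, hS, ⟨Triangle.isoMk _ _ e₁ e₂ e₃ h₁ h₂ h₃⟩⟩
  · rintro ⟨S, hS, ⟨e⟩⟩
    exact mem_stableDistTriang_of_iso δ (mem_stableDistTriang_of_mem δ S hS) e

variable {δ} (hE : IsFrobenius E) (hπ : IsStableQuotient E π)
  (hδ : ∀ (S S' : ShortComplex B) (hS : E S) (hS' : E S') (φ : S ⟶ S'),
    π.map φ.τ₃ ≫ δ S' hS' = δ S hS ≫ (π.map φ.τ₁)⟦(1 : ℤ)⟧')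
  (hδ' : ∀ (S : ShortComplex B) (hS : E S), IsInjective E S.X₂ → IsIso (δ S hS))

include hE hπ hδ in
-- Representatives of `a` and `b` commute with the first maps only up to a map through an injective.
-- That error extends along the admissible monomorphism `S.f` and is absorbed into `b₀`; the
-- corrected square commutes strictly and induces a map of conflations.
lemma stableDistTriang_complete {T₁ T₂ : Triangle D} (h₁ : T₁ ∈ stableDistTriang δ)
    (h₂ : T₂ ∈ stableDistTriang δ) (a : T₁.obj₁ ⟶ T₂.obj₁) (b : T₁.obj₂ ⟶ T₂.obj₂)
    (hab : T₁.mor₁ ≫ b = a ≫ T₂.mor₁) :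
    ∃ c : T₁.obj₃ ⟶ T₂.obj₃, T₁.mor₂ ≫ c = b ≫ T₂.mor₂ ∧ T₁.mor₃ ≫ a⟦1⟧' = c ≫ T₂.mor₃ := by
  have := hπ.full
  have := hπ.additive
  obtain ⟨S, hS, e₁, e₂, e₃, i₁, i₂, i₃⟩ := h₁
  obtain ⟨S', hS', e₁', e₂', e₃', i₁', i₂', i₃'⟩ := h₂
  obtain ⟨a₀, ha₀⟩ := π.map_surjective (e₁.inv ≫ a ≫ e₁'.hom)
  obtain ⟨b₀, hb₀⟩ := π.map_surjective (e₂.inv ≫ b ≫ e₂'.hom)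
  have hab₀ : π.map (S.f ≫ b₀) = π.map (a₀ ≫ S'.f) := by
    rw [π.map_comp, π.map_comp, ha₀, hb₀, ← cancel_epi e₁.hom, ← reassoc_of% i₁]
    simp [reassoc_of% hab, i₁']
  obtain ⟨I, x, y, hI, hxy⟩ := (hπ.map_eq_iff _ _).1 hab₀
  obtain ⟨x', hx'⟩ := hI S.f x (conf_of_mem hS).admissibleMono
  have hb : π.map (b₀ - x' ≫ y) = π.map b₀ := (hπ.map_eq_iff _ _).2 ⟨I, x', -y, hI, by simp⟩
  have w : S.f ≫ (b₀ - x' ≫ y) = a₀ ≫ S'.f := by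
    rw [Preadditive.comp_sub, reassoc_of% hx', hxy, sub_sub_cancel]
  obtain ⟨c, hc⟩ := hE.exact.desc (conf_of_mem hS) ((b₀ - x' ≫ y) ≫ S'.g)
    (by rw [reassoc_of% w, S'.zero, comp_zero])
  let φ : S ⟶ S' := { τ₁ := a₀, τ₂ := b₀ - x' ≫ y, τ₃ := c, comm₁₂ := w.symm, comm₂₃ := hc.symm }
  have h₃ : π.map c ≫ δ S' hS' = δ S hS ≫ (π.map a₀)⟦(1 : ℤ)⟧' := hδ S S' hS hS' φ
  refine ⟨e₃.hom ≫ π.map c ≫ e₃'.inv, ?_, ?_⟩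
  · rw [reassoc_of% i₂, ← π.map_comp_assoc, hc, π.map_comp_assoc, hb, hb₀,
      ← cancel_mono e₃'.hom]
    simp [i₂']
  · rw [← cancel_mono (e₁'.hom⟦(1 : ℤ)⟧'), Category.assoc, Category.assoc, Category.assoc,
      Category.assoc, i₃', Iso.inv_hom_id_assoc, h₃, ha₀, ← reassoc_of% i₃, ← Functor.map_comp,
      ← Functor.map_comp]
    simp

include hE hπ in
lemma stableDistTriang_cocone {X Y : D} (f : X ⟶ Y) :
    ∃ (Z : D) (g : Y ⟶ Z) (h : Z ⟶ X⟦(1 : ℤ)⟧), Triangle.mk f g h ∈ stableDistTriang δ := by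
  have := hπ.essSurj
  let e := (π.objObjPreimageIso X).symm
  obtain ⟨Y', j, e', hj, w⟩ := hπ.exists_admissibleMono hE f e
  obtain ⟨Z, p, hp⟩ := hj.conf
  exact ⟨π.obj Z, e'.hom ≫ π.map p, δ (ShortComplex.mk j p hp.w) hp.2 ≫ e.inv⟦1⟧',
    mk_mem_stableDistTriang δ (ShortComplex.mk j p hp.w) hp.2 e e' (Iso.refl _) w (by simp)
      (by simp [← Functor.map_comp])⟩

include hE hπ in
lemma stableDistTriang_contractible [HasZeroObject D] (X : D) :
    contractibleTriangle X ∈ stableDistTriang δ := by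
  have := hπ.essSurj
  have := hπ.additive
  obtain ⟨Z, hZ⟩ := hE.exact.hasZeroObject
  let Y := π.objPreimage X
  have h : Conf E (𝟙 Y) (0 : Y ⟶ Z) := hE.exact.conf_of_splitting (by simp)
    ⟨𝟙 _, 0, by simp, hZ.eq_of_src _ _, by simp⟩
  have hZ' : IsZero (π.obj Z) := π.map_isZero hZ
  let e := (π.objObjPreimageIso X).symm
  exact mk_mem_stableDistTriang δ (ShortComplex.mk (𝟙 Y) (0 : Y ⟶ Z) h.w) h.2 e e
    ((isZero_zero D).iso hZ') (by simp [Y]) (hZ'.eq_of_tgt _ _) ((isZero_zero D).eq_of_src _ _)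

include hE hπ hδ hδ' in
-- Embed `S.X₂` in an injective `J` and push out along `S.g`. The pushout `P` is also the cokernel
-- of `S.X₁ ↣ J`, hence the suspension of `S.X₁`, and `S.X₂ ↣ J ⊞ S.X₃ ↠ P` represents the rotated
-- triangle.
lemma stableDistTriang_rotate [∀ n : ℤ, (shiftFunctor D n).Additive] {T : Triangle D}
    (hT : T ∈ stableDistTriang δ) : T.rotate ∈ stableDistTriang δ := by
  have := hπ.additive
  have := hE.exact.hasBinaryBiproducts
  obtain ⟨S, hS, e₁, e₂, e₃, i₁, i₂, i₃⟩ := hT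
  obtain ⟨J, j, hJ, hj⟩ := hE.enoughInjectives S.X₂
  obtain ⟨R, r, hr⟩ := hj.conf
  obtain ⟨P, f, k, s, h₁, -, hP, -⟩ := hE.exact.exists_noether (conf_of_mem hS) hr
  have h₂ := hE.exact.conf_of_isPushout hj hP
  let S₁ := ShortComplex.mk (S.f ≫ j) f h₁.w
  let S₂ := ShortComplex.mk (biprod.lift j S.g) (biprod.desc f (-k)) h₂.w
  let φ : S ⟶ S₁ := { τ₁ := 𝟙 _, τ₂ := j, τ₃ := k, comm₁₂ := by simp [S₁], comm₂₃ := hP.w }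
  let ψ : S₁ ⟶ S₂ :=
    { τ₁ := S.f, τ₂ := biprod.inl, τ₃ := 𝟙 _
      comm₁₂ := by dsimp [S₁, S₂]; ext <;> simp
      comm₂₃ := by simp [S₁, S₂] }
  have hφ : π.map k ≫ δ S₁ h₁.2 = δ S hS := by
    simpa [φ] using hδ S S₁ hS h₁.2 φ
  have hψ : δ S₂ h₂.2 = δ S₁ h₁.2 ≫ (π.map S.f)⟦(1 : ℤ)⟧' := by
    simpa [ψ, S₁, S₂] using hδ S₁ S₂ h₁.2 h₂.2 ψ
  have := hπ.isIso_map_snd hJ S.X₃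
  have : IsIso (δ S₁ h₁.2) := hδ' _ _ hJ
  -- The sign of the pushout conflation survives in the quotient and accounts for the sign in the
  -- definition of rotation; this is why `P` is identified with the suspension by `-δ`.
  have hdesc : π.map (biprod.desc f (-k)) = - π.map (biprod.snd ≫ k : J ⊞ S.X₃ ⟶ P) := by
    rw [← π.map_neg]
    refine (hπ.map_eq_iff _ _).2 ⟨J, biprod.fst, f, hJ, ?_⟩
    ext <;> simp
  refine mk_mem_stableDistTriang δ S₂ h₂.2 e₂
    (e₃ ≪≫ (asIso (π.map (biprod.snd : J ⊞ S.X₃ ⟶ S.X₃))).symm)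
    ((shiftFunctor D (1 : ℤ)).mapIso e₁ ≪≫ (-(asIso (δ S₁ h₁.2))).symm) ?_ ?_ ?_
  · rw [← cancel_mono (π.map (biprod.snd : J ⊞ S.X₃ ⟶ S.X₃)), Category.assoc, Category.assoc,
      ← π.map_comp]
    simp [S₂, i₂]
  · rw [← cancel_mono (-(asIso (δ S₁ h₁.2))).hom]
    simp [S₂, hdesc, hφ, i₃]
  · rw [hψ]
    simp [← Functor.map_comp, i₁]

include hE hπ hδ hδ' in
-- Dually to rotation, cover `S.X₂` by a projective `P` and pull back along `S.f`; the conflation `K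
-- ↣ P ⊞ S.X₁ ↠ S.X₂` represents `T` itself.
lemma stableDistTriang_of_rotate [∀ n : ℤ, (shiftFunctor D n).Additive] {T : Triangle D}
    (hT : T.rotate ∈ stableDistTriang δ) : T ∈ stableDistTriang δ := by
  have := hπ.additive
  have := hE.exact.hasBinaryBiproducts
  obtain ⟨S, hS, (e₁ : T.obj₂ ≅ π.obj S.X₁), (e₂ : T.obj₃ ≅ π.obj S.X₂),
    (e₃ : T.obj₁⟦(1 : ℤ)⟧ ≅ π.obj S.X₃), (i₁ : T.mor₂ ≫ e₂.hom = e₁.hom ≫ π.map S.f),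
    (i₂ : T.mor₃ ≫ e₃.hom = e₂.hom ≫ π.map S.g),
    (i₃ : (-T.mor₁⟦(1 : ℤ)⟧') ≫ e₁.hom⟦(1 : ℤ)⟧' = e₃.hom ≫ δ S hS)⟩ := hT
  obtain ⟨P, d, hP, hd⟩ := hE.enoughProjectives S.X₂
  have hPI : IsInjective E P := (hE.projective_iff_injective _).1 hP
  obtain ⟨L, l, hl⟩ := hd.conf
  obtain ⟨K, m, t, s, h₁, -, hPB, -⟩ := hE.exact.exists_noether_epi hl (conf_of_mem hS)
  have h₂ := hE.exact.conf_of_isPullback hd hPB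
  let S₁ := ShortComplex.mk m (d ≫ S.g) h₁.w
  let S₂ := ShortComplex.mk (biprod.lift m t) (biprod.desc d (-S.f)) h₂.w
  let φ : S₁ ⟶ S := { τ₁ := t, τ₂ := d, τ₃ := 𝟙 _, comm₁₂ := hPB.w.symm, comm₂₃ := by simp [S₁] }
  let ψ : S₂ ⟶ S₁ :=
    { τ₁ := 𝟙 _, τ₂ := biprod.fst, τ₃ := S.g
      comm₁₂ := by simp [S₁, S₂]
      comm₂₃ := by dsimp [S₁, S₂]; ext <;> simp }
  have hφ : δ S hS = δ S₁ h₁.2 ≫ (π.map t)⟦(1 : ℤ)⟧' := by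
    simpa [φ, S₁] using hδ S₁ S h₁.2 hS φ
  have hψ : π.map S.g ≫ δ S₁ h₁.2 = δ S₂ h₂.2 := by
    simpa [ψ, S₁, S₂] using hδ S₂ S₁ h₂.2 h₁.2 ψ
  have := hπ.isIso_map_snd hPI S.X₁
  have hiso : IsIso (δ S₁ h₁.2) := hδ' _ _ hPI
  have hdesc : π.map (biprod.desc d (-S.f)) = - π.map (biprod.snd ≫ S.f : P ⊞ S.X₁ ⟶ S.X₂) := by
    rw [← π.map_neg]
    refine (hπ.map_eq_iff _ _).2 ⟨P, biprod.fst, d, hPI, ?_⟩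
    ext <;> simp
  let e₃' : π.obj S.X₃ ≅ (π.obj S₂.X₁)⟦(1 : ℤ)⟧ := @asIso _ _ _ _ (δ S₁ h₁.2) hiso
  let s : π.obj S₂.X₂ ≅ π.obj S.X₁ := asIso (π.map (biprod.snd : P ⊞ S.X₁ ⟶ S.X₁))
  have hs : s.hom = π.map biprod.snd := rfl
  have c₁ : T.mor₂ ≫ e₂.hom = (e₁ ≪≫ (-s).symm).hom ≫ π.map S₂.g := by
    have : (-s).hom ≫ π.map S.f = π.map S₂.g := by
      dsimp [S₂]
      rw [hdesc, hs, Preadditive.neg_comp, π.map_comp]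
    rw [← this, i₁, Iso.trans_hom, Iso.symm_hom, Category.assoc, Iso.inv_hom_id_assoc]
  have c₂ : T.mor₃ ≫ (e₃ ≪≫ e₃').hom = e₂.hom ≫ δ S₂ h₂.2 := by
    rw [Iso.trans_hom, reassoc_of% i₂, ← hψ]
    rfl
  have c₃ : (-T.mor₁⟦(1 : ℤ)⟧') ≫ (e₁ ≪≫ (-s).symm).hom⟦(1 : ℤ)⟧' =
      (e₃ ≪≫ e₃').hom ≫ (-(π.map S₂.f)⟦(1 : ℤ)⟧') := by
    have : (π.map S₂.f ≫ (-s).hom) = - π.map t := by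
      change π.map (biprod.lift m t) ≫ (-π.map biprod.snd) = _
      rw [Preadditive.comp_neg, ← π.map_comp, biprod.lift_snd]
    rw [← cancel_mono ((-s).hom⟦(1 : ℤ)⟧'), Category.assoc, ← Functor.map_comp,
      Iso.trans_hom, Category.assoc, Iso.symm_hom, Iso.inv_hom_id, Category.comp_id, i₃, hφ,
      Category.assoc, Preadditive.neg_comp, ← Functor.map_comp, this, Functor.map_neg,
      neg_neg, Iso.trans_hom, Category.assoc]
    rfl
  -- Comparing after rotation suffices, since rotation is an equivalence on triangles; no
  -- desuspension of `e₃` has to be written down.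
  let e : T.rotate ≅ (Triangle.mk (π.map S₂.f) (π.map S₂.g) (δ S₂ h₂.2)).rotate :=
    triangleMkIso _ _ _ c₁ c₂ c₃
  exact mem_stableDistTriang_of_iso δ (mem_stableDistTriang_of_mem δ S₂ h₂.2)
    ((triangleRotation D).functor.preimageIso e)

/-- The pretriangulated structure on a stable category. -/
@[reducible]
def stablePretriangulated [HasZeroObject D] [∀ n : ℤ, (shiftFunctor D n).Additive]
    (hE : IsFrobenius E) (hπ : IsStableQuotient E π)
    (hδ : ∀ (S S' : ShortComplex B) (hS : E S) (hS' : E S') (φ : S ⟶ S'),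
      π.map φ.τ₃ ≫ δ S' hS' = δ S hS ≫ (π.map φ.τ₁)⟦(1 : ℤ)⟧')
    (hδ' : ∀ (S : ShortComplex B) (hS : E S), IsInjective E S.X₂ → IsIso (δ S hS)) :
    Pretriangulated D where
  distinguishedTriangles := stableDistTriang δ
  isomorphic_distinguished := fun _ h _ e => mem_stableDistTriang_of_iso δ h e
  contractible_distinguished := stableDistTriang_contractible hE hπ
  distinguished_cocone_triangle := stableDistTriang_cocone hE hπ
  rotate_distinguished_triangle := fun _ =>
    ⟨stableDistTriang_rotate hE hπ hδ hδ', stableDistTriang_of_rotate hE hπ hδ hδ'⟩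
  complete_distinguished_triangle_morphism := fun _ _ h₁ h₂ =>
    stableDistTriang_complete hE hπ hδ h₁ h₂

/-- Up to isomorphism the two maps are composable admissible monomorphisms `i` and `j`. The
octahedron is then the conflation of cokernels `Q ↣ P ↠ R` of the third isomorphism theorem, and its
relations are naturality of `δ` for three maps of conflations. -/
lemma stable_isTriangulated [HasZeroObject D] [∀ n : ℤ, (shiftFunctor D n).Additive] :
    letI := stablePretriangulated hE hπ hδ hδ'
    IsTriangulated D := by
  let _ := stablePretriangulated hE hπ hδ hδ'
  have := hπ.essSurj
  refine IsTriangulated.mk' fun X₁ X₂ X₃ u v => ?_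
  let e₁ := (π.objObjPreimageIso X₁).symm
  obtain ⟨Y₂, i, e₂, hi, wi⟩ := hπ.exists_admissibleMono hE u e₁
  obtain ⟨Y₃, j, e₃, hj, wj⟩ := hπ.exists_admissibleMono hE v e₂
  obtain ⟨Q, p, hp⟩ := hi.conf
  obtain ⟨R, r, hr⟩ := hj.conf
  obtain ⟨P, f, k, s, h₁, h₂, hP, hs⟩ := hE.exact.exists_noether hp hr
  let S₁₂ := ShortComplex.mk i p hp.w
  let S₂₃ := ShortComplex.mk j r hr.w
  let S₁₃ := ShortComplex.mk (i ≫ j) f h₁.w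
  let S := ShortComplex.mk k s h₂.w
  have n₁ := hδ S₁₂ S₁₃ hp.2 h₁.2
    { τ₁ := 𝟙 _, τ₂ := j, τ₃ := k, comm₁₂ := by simp [S₁₂, S₁₃], comm₂₃ := hP.w }
  have n₂ := hδ S₁₃ S₂₃ h₁.2 hr.2
    { τ₁ := i, τ₂ := 𝟙 _, τ₃ := s, comm₁₂ := by simp [S₁₃, S₂₃],
      comm₂₃ := by simp [S₁₃, S₂₃, hs] }
  have n₃ := hδ S₂₃ S hr.2 h₂.2
    { τ₁ := p, τ₂ := f, τ₃ := 𝟙 _, comm₁₂ := hP.w.symm, comm₂₃ := by simp [S₂₃, S, hs] }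
  refine ⟨_, _, _, π.obj Q, π.obj R, π.obj P, π.map i, π.map j, e₁, e₂, e₃, wi, wj, π.map p,
    δ S₁₂ hp.2, mem_stableDistTriang_of_mem δ S₁₂ hp.2, π.map r, δ S₂₃ hr.2,
    mem_stableDistTriang_of_mem δ S₂₃ hr.2, π.map f, δ S₁₃ h₁.2, ?_,
    ⟨⟨π.map k, π.map s, ?_, ?_, ?_, ?_, ?_⟩⟩⟩
  · exact mk_mem_stableDistTriang δ S₁₃ h₁.2 (Iso.refl _) (Iso.refl _) (Iso.refl _)
      (by simp [S₁₃]) (by simp [S₁₃]) (by simp)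
  · rw [← π.map_comp, ← π.map_comp, hP.w]
  · simpa using n₁
  · rw [← π.map_comp, hs]
  · exact n₂.symm
  · exact mk_mem_stableDistTriang δ S h₂.2 (Iso.refl _) (Iso.refl _) (Iso.refl _)
      (by simp [S]) (by simp [S]) (by simpa [S₂₃, S] using n₃.symm)

end StableTriangulation

/-- The stable category of a Frobenius category is triangulated. -/
theorem IsStableQuotient.exists_triangulation {B : Type u} [Category.{v} B] [Preadditive B]
    {E : ObjectProperty (ShortComplex B)} {D : Type u₂} [Category.{v₂} D] [Preadditive D]
    (hE : IsFrobenius E) {π : B ⥤ D} (hπ : IsStableQuotient E π) :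
    ∃ (_ : HasZeroObject D) (_ : HasShift D ℤ) (_ : ∀ n : ℤ, (shiftFunctor D n).Additive)
      (_ : Pretriangulated D), IsTriangulated D ∧ IsStableTriangulation E π := by
  have := hπ.additive
  have hZ : HasZeroObject D := by
    have := hE.exact.hasZeroObject
    exact π.hasZeroObject_of_additive
  obtain ⟨_, _, δ, hδ, hδ'⟩ := exists_shift_and_connecting hE hπ
  let _ := stablePretriangulated hE hπ hδ hδ'
  refine ⟨inferInstance, inferInstance, inferInstance, inferInstance,
    stable_isTriangulated hE hπ hδ hδ', hπ.additive,
    fun S hS hI => haveI := hδ' S hS hI; asIso (δ S hS),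
    fun S S' hS hI hS' hI' φ => hδ S S' hS hS' φ, fun T => ⟨?_, ?_⟩⟩
  · intro hT
    obtain ⟨S, hS, ⟨e⟩⟩ := (mem_stableDistTriang_iff δ T).1 hT
    obtain ⟨I, i, hI, Z, p, w, h⟩ := hE.enoughInjectives S.X₁
    -- Naturality of `δ` along a map that is the identity on the first term gives `δ S = π c ≫ σ`,
    -- the form required by the definition.
    obtain ⟨φ, hφ⟩ := hE.exact.exists_hom_of_injective hS (S' := ShortComplex.mk i p w) hI (𝟙 _)
    refine ⟨S, hS, I, Z, i, p, w, h, hI, φ.τ₂, φ.τ₃, ?_, φ.comm₂₃.symm, ?_⟩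
    · simpa [hφ] using φ.comm₁₂.symm
    · have := hδ S (ShortComplex.mk i p w) hS h φ
      rw [hφ, π.map_id, CategoryTheory.Functor.map_id, Category.comp_id] at this
      exact ⟨e ≪≫ eqToIso (by rw [← this]; rfl)⟩
  · rintro ⟨S, hS, I, Z, i, p, w, h, hI, e, c, he, hc, ⟨t⟩⟩
    refine (mem_stableDistTriang_iff δ T).2 ⟨S, hS, ⟨t ≪≫ eqToIso ?_⟩⟩
    have := hδ S (ShortComplex.mk i p w) hS h
      { τ₁ := 𝟙 _, τ₂ := e, τ₃ := c, comm₁₂ := by simp [he], comm₂₃ := hc.symm }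
    rw [π.map_id, CategoryTheory.Functor.map_id, Category.comp_id] at this
    rw [← this]
    rfl

/-! ### The right class as a Frobenius category -/

section Cotorsion

variable {A : Type u} [Category.{v} A] [Preadditive A] {E : ObjectProperty (ShortComplex A)}

lemma IsExactCategory.splitting_of_retraction (hE : IsExactCategory E) {X Y Z : A} {i : X ⟶ Y}
    {p : Y ⟶ Z} (h : Conf E i p) {r : Y ⟶ X} (hr : i ≫ r = 𝟙 X) :
    Nonempty (ShortComplex.mk i p h.w).Splitting := by
  obtain ⟨s, hs⟩ := hE.desc h (𝟙 Y - r ≫ i) (by simp [reassoc_of% hr])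
  have := hE.epi h
  exact ⟨⟨r, s, hr, by rw [← cancel_epi p]; simp [reassoc_of% hs, h.w], by simp [hs]⟩⟩

lemma IsExactCategory.splitting_of_section (hE : IsExactCategory E) {X Y Z : A} {i : X ⟶ Y}
    {p : Y ⟶ Z} (h : Conf E i p) {s : Z ⟶ Y} (hs : s ≫ p = 𝟙 Z) :
    Nonempty (ShortComplex.mk i p h.w).Splitting := by
  obtain ⟨r, hr⟩ := hE.lift h (𝟙 Y - p ≫ s) (by simp [hs])
  have := hE.mono h
  exact ⟨⟨r, s, by rw [← cancel_mono i]; simp [hr, reassoc_of% h.w], hs, by simp [hr]⟩⟩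

lemma isInjective_of_retract {X I : A} (hI : IsInjective E I) {i : X ⟶ I} {r : I ⟶ X}
    (h : i ≫ r = 𝟙 X) : IsInjective E X := by
  intro Y Z j f hj
  obtain ⟨g, hg⟩ := hI j (f ≫ i) hj
  exact ⟨g ≫ r, by rw [reassoc_of% hg, h, Category.comp_id]⟩

lemma isInjective_of_isZero {X : A} (hX : IsZero X) : IsInjective E X :=
  fun _ _ _ => ⟨0, hX.eq_of_tgt _ _⟩

namespace IsInjectiveCotorsionPair

variable (hE : IsExactCategory E) {W F : ObjectProperty A} (hWF : IsInjectiveCotorsionPair E W F)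
include hE hWF

/-- The pushout of the conflation along `f` lies in `Ext¹(Z, Q) = 0`, hence splits. The next lemma
uses the pullback in the same way. -/
lemma exists_extension {X Y Z Q : A} {i : X ⟶ Y} {p : Y ⟶ Z} (h : Conf E i p) (hZ : W Z)
    (hQ : F Q) (f : X ⟶ Q) : ∃ g : Y ⟶ Q, i ≫ g = f := by
  obtain ⟨Y', f', i', p', hP, h', -⟩ := hE.exists_pushout h f
  obtain ⟨s⟩ := (hWF.complete.right_iff Q).1 hQ Z hZ _ _ _ h'.w h'.2
  have hs : i' ≫ s.r = 𝟙 Q := s.f_r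
  exact ⟨f' ≫ s.r, by rw [hP.w_assoc, hs, Category.comp_id]⟩

lemma exists_lifting {X Y Z Q : A} {i : X ⟶ Y} {p : Y ⟶ Z} (h : Conf E i p) (hX : F X)
    (hQ : W Q) (f : Q ⟶ Z) : ∃ g : Q ⟶ Y, g ≫ p = f := by
  obtain ⟨Y', f', p', i', hP, h', -⟩ := hE.exists_pullback h f
  obtain ⟨s⟩ := (hWF.complete.right_iff X).1 hX Q hQ _ _ _ h'.w h'.2
  have hs : s.s ≫ p' = 𝟙 Q := s.s_g
  exact ⟨s.s ≫ f', by rw [Category.assoc, hP.w, reassoc_of% hs]⟩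

lemma right_of_retractions {Y : A}
    (h : ∀ {Z X : A} (i : Y ⟶ Z) (p : Z ⟶ X), Conf E i p → W X → ∃ r : Z ⟶ Y, i ≫ r = 𝟙 Y) :
    F Y :=
  (hWF.complete.right_iff Y).2 fun X hX Z i p w hS => by
    obtain ⟨r, hr⟩ := h i p ⟨w, hS⟩ hX
    exact hE.splitting_of_retraction ⟨w, hS⟩ hr

/-- The right class is closed under extensions. -/
lemma right_extension {X Y Z : A} {i : X ⟶ Y} {p : Y ⟶ Z} (h : Conf E i p) (hX : F X)
    (hZ : F Z) : F Y :=
  hWF.right_of_retractions hE fun {V w} j q hj hw => by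
    -- The map `V ↠ w` factors as `V ↠ P ↠ w` with kernels `X` and `Z`, both in `F`; lifting the
    -- identity of `w` in two stages gives a section.
    obtain ⟨P, f, k, s, h₁, h₂, -, hs⟩ := hE.exists_noether h hj
    obtain ⟨t, ht⟩ := hWF.exists_lifting hE h₂ hZ hw (𝟙 w)
    obtain ⟨g, hg⟩ := hWF.exists_lifting hE h₁ hX hw t
    obtain ⟨σ⟩ := hE.splitting_of_section hj (s := g) (by rw [← hs, reassoc_of% hg, ht])
    exact ⟨σ.r, σ.f_r⟩

lemma exists_cofibrantReplacement (X : A) :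
    ∃ (K P : A) (k : K ⟶ P) (p : P ⟶ X), Conf E k p ∧ F K ∧ W P := by
  obtain ⟨S, hS, hK, hP, ⟨e⟩⟩ := hWF.complete.enoughProjectives X
  exact ⟨S.X₁, S.X₂, S.f, S.g ≫ e.hom, hE.conf_of_iso (conf_of_mem hS) (Iso.refl _) (Iso.refl _)
    e (by simp) (by simp), hK, hP⟩

/-- The right class is closed under cokernels of admissible monomorphisms. -/
lemma right_cokernel {X Y Z : A} {i : X ⟶ Y} {p : Y ⟶ Z} (h : Conf E i p) (hX : F X)
    (hY : F Y) : F Z :=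
  hWF.right_of_retractions hE fun {V w} j q hj hw => by
    obtain ⟨K, P, k, a, ha, hK, hP⟩ := hWF.exists_cofibrantReplacement hE V
    -- Here `L` is the kernel of `P ↠ V ↠ w`, so thickness puts it in `W`. Thus `L ⟶ Z` lifts to
    -- `Y`, the lift extends over `P` as `Y` is in `F`, and its composite with `p` descends to the
    -- retraction `V ⟶ Z`.
    obtain ⟨L, m, t, s, h₁, h₂, hPB, hs⟩ := hE.exists_noether_epi ha hj
    have hL : W L := hWF.thick.left _ h₁.2 hP hw
    obtain ⟨l, hl⟩ := hWF.exists_lifting hE h hX hL t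
    obtain ⟨g, hg⟩ := hWF.exists_extension hE h₁ hw hY l
    obtain ⟨r, hr⟩ := hE.desc ha (g ≫ p) (by
      rw [← hs, Category.assoc, reassoc_of% hg, hl, h₂.w])
    have := hE.epi h₂
    refine ⟨r, ?_⟩
    rw [← cancel_epi t, ← reassoc_of% hPB.w, hr, reassoc_of% hg, hl, Category.comp_id]

omit hE in
lemma left_of_isZero {X : A} (hX : IsZero X) : W X :=
  ((hWF.inter_iff X).2 (isInjective_of_isZero hX)).1

omit hE in
lemma right_of_isZero {X : A} (hX : IsZero X) : F X :=
  ((hWF.inter_iff X).2 (isInjective_of_isZero hX)).2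

lemma right_biprod [HasBinaryBiproducts A] {X Y : A} (hX : F X) (hY : F Y) : F (X ⊞ Y) :=
  hWF.right_extension hE (hE.conf_inl_snd X Y) hX hY

lemma exists_fibrantReplacement (X : A) :
    ∃ (R Q : A) (j : X ⟶ R) (p : R ⟶ Q), Conf E j p ∧ F R ∧ W Q := by
  obtain ⟨S, hS, ⟨e⟩, hR, hQ⟩ := hWF.complete.enoughInjectives X
  exact ⟨S.X₂, S.X₃, e.inv ≫ S.f, S.g, hE.conf_of_iso (conf_of_mem hS) e (Iso.refl _)
    (Iso.refl _) (by simp) (by simp), hR, hQ⟩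

end IsInjectiveCotorsionPair

lemma isKernelCokernelPair_of_lifts {X Y Z : A} {i : X ⟶ Y} {p : Y ⟶ Z} (w : i ≫ p = 0)
    [Mono i] [Epi p] (hi : ∀ {T : A} (f : T ⟶ Y), f ≫ p = 0 → ∃ g, g ≫ i = f)
    (hp : ∀ {T : A} (f : Y ⟶ T), i ≫ f = 0 → ∃ g, p ≫ g = f) :
    IsKernelCokernelPair (ShortComplex.mk i p w) :=
  ⟨⟨KernelFork.IsLimit.ofι' i w fun k hk => ⟨(hi k hk).choose, (hi k hk).choose_spec⟩⟩,
    ⟨CokernelCofork.IsColimit.ofπ' p w fun k hk => ⟨(hp k hk).choose, (hp k hk).choose_spec⟩⟩⟩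

section Restrict

variable {F : ObjectProperty A}

lemma conf_restrict_iff {X Y Z : F.FullSubcategory} (i : X ⟶ Y) (p : Y ⟶ Z) :
    Conf (restrict E F) i p ↔ Conf E i.hom p.hom :=
  ⟨fun h => ⟨congrArg (·.hom) h.w, h.2⟩, fun h => ⟨F.hom_ext h.w, h.2⟩⟩

lemma admissibleMono_hom {X Y : F.FullSubcategory} {i : X ⟶ Y}
    (h : AdmissibleMono (restrict E F) i) : AdmissibleMono E i.hom := by
  obtain ⟨Z, p, h⟩ := h.conf
  exact ((conf_restrict_iff _ _).1 h).admissibleMono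

lemma isInjective_restrict {X : F.FullSubcategory} (h : IsInjective E X.obj) :
    IsInjective (restrict E F) X := fun i f hi => by
  obtain ⟨g, hg⟩ := h i.hom f.hom (admissibleMono_hom hi)
  exact ⟨ObjectProperty.homMk g, F.hom_ext hg⟩

end Restrict

variable (hE : IsExactCategory E) {W F : ObjectProperty A} (hWF : IsInjectiveCotorsionPair E W F)

include hE hWF

/-- Closure under extensions serves direct sums, composites of admissible epimorphisms, pushouts and
pullbacks; composites of admissible monomorphisms need closure under cokernels. -/
lemma isExactCategory_restrict : IsExactCategory (restrict E F) where
  hasZeroObject := by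
    obtain ⟨Z, hZ⟩ := hE.hasZeroObject
    refine ⟨⟨Z, hWF.right_of_isZero hZ⟩, ?_⟩
    rw [IsZero.iff_id_eq_zero]
    exact F.hom_ext (hZ.eq_of_src _ _)
  hasBinaryBiproducts := ⟨fun X Y => by
    have := hE.hasBinaryBiproducts
    let b : BinaryBicone X Y :=
      { pt := ⟨X.obj ⊞ Y.obj, hWF.right_biprod hE X.property Y.property⟩
        fst := ObjectProperty.homMk biprod.fst
        snd := ObjectProperty.homMk biprod.snd
        inl := ObjectProperty.homMk biprod.inl
        inr := ObjectProperty.homMk biprod.inr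
        inl_fst := F.hom_ext biprod.inl_fst
        inl_snd := F.hom_ext biprod.inl_snd
        inr_fst := F.hom_ext biprod.inr_fst
        inr_snd := F.hom_ext biprod.inr_snd }
    exact HasBinaryBiproduct.mk ⟨b, isBinaryBilimitOfTotal b (F.hom_ext biprod.total)⟩⟩
  kernelCokernel S hS := by
    have h : Conf E S.f.hom S.g.hom := (conf_restrict_iff _ _).1 (conf_of_mem hS)
    have := hE.mono h
    have := hE.epi h
    have : Mono S.f := F.ι.mono_of_mono_map (by assumption)
    have : Epi S.g := F.ι.epi_of_epi_map (by assumption)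
    exact isKernelCokernelPair_of_lifts S.zero
      (fun f hf => by
        obtain ⟨g, hg⟩ := hE.lift h f.hom (congrArg (·.hom) hf)
        exact ⟨ObjectProperty.homMk g, F.hom_ext hg⟩)
      (fun f hf => by
        obtain ⟨g, hg⟩ := hE.desc h f.hom (congrArg (·.hom) hf)
        exact ⟨ObjectProperty.homMk g, F.hom_ext hg⟩)
  closedUnderIso := by
    rintro S S' ⟨e⟩ hS
    exact hE.closedUnderIso _ _ ⟨F.ι.mapShortComplex.mapIso e⟩ hS
  split := by
    rintro S ⟨s⟩
    exact hE.split _ ⟨s.map F.ι⟩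
  mono_comp := by
    intro X Y Z i j hi hj
    obtain ⟨V, q, hq⟩ := (hE.mono_comp _ _ (admissibleMono_hom hi) (admissibleMono_hom hj)).conf
    exact ((conf_restrict_iff (Z := ⟨V, hWF.right_cokernel hE hq X.property Z.property⟩)
      (i ≫ j) (ObjectProperty.homMk q)).2 hq).admissibleMono
  epi_comp := by
    intro X Y Z p q hp hq
    obtain ⟨K, k, hk⟩ := hp.conf
    obtain ⟨L, l, hl⟩ := hq.conf
    obtain ⟨M, m, t, s, h₁, h₂, -, -⟩ := hE.exists_noether_epi ((conf_restrict_iff _ _).1 hk)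
      ((conf_restrict_iff _ _).1 hl)
    exact ((conf_restrict_iff (X := ⟨M, hWF.right_extension hE h₂ K.property L.property⟩)
      (ObjectProperty.homMk m) (p ≫ q)).2 h₁).admissibleEpi
  pushout := by
    intro X Y X' i f hi
    obtain ⟨Z, p, hp⟩ := hi.conf
    obtain ⟨Y', f', i', p', hP, h', -⟩ := hE.exists_pushout ((conf_restrict_iff _ _).1 hp) f.hom
    let Y'' : F.FullSubcategory := ⟨Y', hWF.right_extension hE h' X'.property Z.property⟩
    exact ⟨Y'', ObjectProperty.homMk f', ObjectProperty.homMk i',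
      IsPushout.of_map F.ι (F.hom_ext hP.w) hP,
      ((conf_restrict_iff (Y := Y'') (ObjectProperty.homMk i')
        (ObjectProperty.homMk p')).2 h').admissibleMono⟩
  pullback := by
    intro Y Z Z' p f hp
    obtain ⟨X, i, hi⟩ := hp.conf
    obtain ⟨Y', f', p', i', hP, h', -⟩ := hE.exists_pullback ((conf_restrict_iff _ _).1 hi) f.hom
    let Y'' : F.FullSubcategory := ⟨Y', hWF.right_extension hE h' X.property Z'.property⟩
    exact ⟨Y'', ObjectProperty.homMk f', ObjectProperty.homMk p',
      IsPullback.of_map F.ι (F.hom_ext hP.w) hP,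
      ((conf_restrict_iff (Y := Y'') (ObjectProperty.homMk i')
        (ObjectProperty.homMk p')).2 h').admissibleEpi⟩

lemma isProjective_restrict {X : F.FullSubcategory} (h : W X.obj) :
    IsProjective (restrict E F) X := fun p f hp => by
  obtain ⟨K, k, hk⟩ := hp.conf
  obtain ⟨g, hg⟩ := hWF.exists_lifting hE ((conf_restrict_iff _ _).1 hk) K.property h f.hom
  exact ⟨ObjectProperty.homMk g, F.hom_ext hg⟩

lemma exists_injective_restrict (hI : HasEnoughInjectives E) (X : F.FullSubcategory) :
    ∃ (I : F.FullSubcategory) (i : X ⟶ I), IsInjective E I.obj ∧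
      AdmissibleMono (restrict E F) i := by
  obtain ⟨I, i, hI, hi⟩ := hI X.obj
  obtain ⟨Z, p, hp⟩ := hi.conf
  have hIF := ((hWF.inter_iff I).2 hI).2
  exact ⟨⟨I, hIF⟩, ObjectProperty.homMk i, hI, ((conf_restrict_iff (Y := ⟨I, hIF⟩)
    (Z := ⟨Z, hWF.right_cokernel hE hp X.property hIF⟩) (ObjectProperty.homMk i)
    (ObjectProperty.homMk p)).2 hp).admissibleMono⟩

lemma exists_projective_restrict (X : F.FullSubcategory) :
    ∃ (P : F.FullSubcategory) (p : P ⟶ X), W P.obj ∧ AdmissibleEpi (restrict E F) p := by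
  obtain ⟨K, P, k, p, h, hK, hP⟩ := hWF.exists_cofibrantReplacement hE X.obj
  exact ⟨⟨P, hWF.right_extension hE h hK X.property⟩, ObjectProperty.homMk p, hP,
    ((conf_restrict_iff (X := ⟨K, hK⟩) (Y := ⟨P, _⟩) (ObjectProperty.homMk k)
      (ObjectProperty.homMk p)).2 h).admissibleEpi⟩

lemma isInjective_restrict_iff (hI : HasEnoughInjectives E) (X : F.FullSubcategory) :
    IsInjective (restrict E F) X ↔ IsInjective E X.obj := by
  refine ⟨fun h => ?_, isInjective_restrict⟩
  obtain ⟨I, i, hI, hi⟩ := exists_injective_restrict hE hWF hI X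
  obtain ⟨r, hr⟩ := h i (𝟙 X) hi
  exact isInjective_of_retract hI (congrArg (·.hom) hr)

/-- A relative projective is a retract of its cover, which lies in `W ∩ F` and is therefore
injective. -/
lemma isProjective_restrict_iff (X : F.FullSubcategory) :
    IsProjective (restrict E F) X ↔ IsInjective E X.obj := by
  refine ⟨fun h => ?_, fun h => isProjective_restrict hE hWF ((hWF.inter_iff _).2 h).1⟩
  obtain ⟨P, p, hP, hp⟩ := exists_projective_restrict hE hWF X
  obtain ⟨s, hs⟩ := h p (𝟙 X) hp
  exact isInjective_of_retract ((hWF.inter_iff _).1 ⟨hP, P.property⟩) (congrArg (·.hom) hs)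

/-- The right class of an injective cotorsion pair is a Frobenius category. -/
theorem isFrobenius_restrict (hI : HasEnoughInjectives E) : IsFrobenius (restrict E F) where
  exact := isExactCategory_restrict hE hWF
  enoughInjectives X := by
    obtain ⟨I, i, hI, hi⟩ := exists_injective_restrict hE hWF hI X
    exact ⟨I, i, isInjective_restrict hI, hi⟩
  enoughProjectives X := by
    obtain ⟨P, p, hP, hp⟩ := exists_projective_restrict hE hWF X
    exact ⟨P, p, isProjective_restrict hE hWF hP, hp⟩
  projective_iff_injective X := by
    rw [isProjective_restrict_iff hE hWF, isInjective_restrict_iff hE hWF hI]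

theorem projective_injective_restrict_iff (hI : HasEnoughInjectives E) (X : A) :
    (∃ hX : F X, IsProjective (restrict E F) ⟨X, hX⟩ ∧ IsInjective (restrict E F) ⟨X, hX⟩) ↔
      IsInjective E X := by
  refine ⟨?_, fun h => ⟨((hWF.inter_iff X).2 h).2, (isProjective_restrict_iff hE hWF _).2 h,
    isInjective_restrict h⟩⟩
  rintro ⟨hX, -, h⟩
  exact (isInjective_restrict_iff hE hWF hI _).1 h

end Cotorsion

/-! ### Comparing the homotopy category with the stable category -/

section Localization

variable {A : Type u} [Category.{v} A] [Preadditive A] {E : ObjectProperty (ShortComplex A)}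

lemma trivialCofibrations_of_conf {W : ObjectProperty A} {X Y Z : A} {i : X ⟶ Y} {p : Y ⟶ Z}
    (h : Conf E i p) (hZ : W Z) : trivialCofibrations E W i := ⟨Z, p, h.w, h.2, hZ⟩

lemma trivialCofibrations_conf {W : ObjectProperty A} {X Y : A} {i : X ⟶ Y}
    (h : trivialCofibrations E W i) : ∃ (Z : A) (p : Y ⟶ Z), Conf E i p ∧ W Z := by
  obtain ⟨Z, p, w, h, hZ⟩ := h
  exact ⟨Z, p, ⟨w, h⟩, hZ⟩

variable (hE : IsExactCategory E) {W F : ObjectProperty A} (hWF : IsInjectiveCotorsionPair E W F)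

include hE hWF in
lemma trivialCofibrations_le_weakEquivalences :
    trivialCofibrations E W ≤ weakEquivalences E W F := fun X Y i hi => by
  obtain ⟨Z, hZ⟩ := hE.hasZeroObject
  have h : Conf E (0 : Z ⟶ Y) (𝟙 Y) := hE.conf_of_splitting (by simp)
    ⟨0, 𝟙 _, hZ.eq_of_src _ _, by simp, by simp⟩
  exact ⟨Y, i, 𝟙 Y, hi, ⟨Z, 0, h.w, h.2, hWF.left_of_isZero hZ, hWF.right_of_isZero hZ⟩, by simp⟩

include hE hWF in
/-- A functor which inverts the trivial cofibrations inverts the weak equivalences. -/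
lemma isInvertedBy_weakEquivalences {T : Type u₂} [Category.{v₂} T] (G : A ⥤ T)
    (hG : (trivialCofibrations E W).IsInvertedBy G) : (weakEquivalences E W F).IsInvertedBy G := by
  rintro X Y _ ⟨Z, i, p, hi, ⟨K, k, w, hk, hKW, hKF⟩, rfl⟩
  have hc : Conf E k p := ⟨w, hk⟩
  -- The kernel of a trivial fibration is injective, so the sequence splits, and the section is a
  -- trivial cofibration with cokernel `K`.
  obtain ⟨r, hr⟩ := (hWF.inter_iff K).1 ⟨hKW, hKF⟩ k (𝟙 K) hc.admissibleMono
  obtain ⟨σ⟩ := hE.splitting_of_retraction hc hr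
  have e₁ : k ≫ σ.r = 𝟙 _ := σ.f_r
  have e₂ : σ.s ≫ p = 𝟙 _ := σ.s_g
  have e₃ : σ.r ≫ k + p ≫ σ.s = 𝟙 _ := σ.id
  have e₄ : σ.s ≫ σ.r = 0 := σ.s_r
  have hs : IsIso (G.map σ.s) := hG _ (trivialCofibrations_of_conf
    (hE.conf_of_splitting e₄ ⟨p, k, e₂, e₁, by rw [← e₃]; exact add_comm _ _⟩) hKW)
  have hp : IsIso (G.map p) := by
    have : G.map σ.s ≫ G.map p = 𝟙 _ := by rw [← G.map_comp, e₂, G.map_id]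
    rw [← IsIso.inv_eq_of_hom_inv_id this]
    infer_instance
  have := hG i hi
  rw [G.map_comp]
  infer_instance

include hE hWF in
lemma isIso_localizationFunctor_map {X Y : A} {i : X ⟶ Y} (hi : trivialCofibrations E W i) :
    IsIso ((localizationFunctor E W F).map i) :=
  (weakEquivalences E W F).Q_inverts i (trivialCofibrations_le_weakEquivalences hE hWF i hi)

include hE hWF in
-- A cylinder-type argument: `biprod.fst` and `(𝟙, b)` are both retractions of the trivial
-- cofibration `Y ↣ Y ⊞ I`, so they agree after localization; precomposed with `(f, a)` they give
-- `f` and `g`.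
lemma localizationFunctor_map_eq {X Y : F.FullSubcategory} {f g : X ⟶ Y}
    (h : homotopic W F f g) :
    (localizationFunctor E W F).map f.hom = (localizationFunctor E W F).map g.hom := by
  have := hE.hasBinaryBiproducts
  obtain ⟨I, a, b, hI, hab⟩ := h
  have := isIso_localizationFunctor_map hE hWF
    (trivialCofibrations_of_conf (hE.conf_inl_snd Y.obj I.obj) hI)
  have e : (localizationFunctor E W F).map (biprod.fst : Y.obj ⊞ I.obj ⟶ _) =
      (localizationFunctor E W F).map (biprod.desc (𝟙 Y.obj) b.hom) := by
    rw [← cancel_epi ((localizationFunctor E W F).map (biprod.inl : Y.obj ⟶ Y.obj ⊞ I.obj)),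
      ← Functor.map_comp, ← Functor.map_comp, biprod.inl_fst, biprod.inl_desc]
  have hab' : a.hom ≫ b.hom = g.hom - f.hom := congrArg (·.hom) hab
  have h₁ : biprod.lift f.hom a.hom ≫ biprod.fst = f.hom := biprod.lift_fst _ _
  have h₂ : biprod.lift f.hom a.hom ≫ biprod.desc (𝟙 Y.obj) b.hom = g.hom := by
    rw [biprod.lift_desc, Category.comp_id, hab', add_sub_cancel]
  rw [← h₂, Functor.map_comp, ← e, ← Functor.map_comp, h₁]

include hE hWF in
lemma homotopic_add {X Y : F.FullSubcategory} {f₁ f₂ g₁ g₂ : X ⟶ Y} (h : homotopic W F f₁ f₂)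
    (h' : homotopic W F g₁ g₂) : homotopic W F (f₁ + g₁) (f₂ + g₂) := by
  have := hE.hasBinaryBiproducts
  obtain ⟨I, a, b, hI, hab⟩ := h
  obtain ⟨J, c, d, hJ, hcd⟩ := h'
  have hIJ : W (I.obj ⊞ J.obj) := hWF.thick.middle _ (hE.conf_inl_snd I.obj J.obj).2 hI hJ
  refine ⟨⟨I.obj ⊞ J.obj, hWF.right_biprod hE I.property J.property⟩,
    ObjectProperty.homMk (biprod.lift a.hom c.hom), ObjectProperty.homMk (biprod.desc b.hom d.hom),
    hIJ, F.hom_ext ?_⟩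
  have hab' : a.hom ≫ b.hom = f₂.hom - f₁.hom := congrArg (·.hom) hab
  have hcd' : c.hom ≫ d.hom = g₂.hom - g₁.hom := congrArg (·.hom) hcd
  change biprod.lift a.hom c.hom ≫ biprod.desc b.hom d.hom =
    (f₂.hom + g₂.hom) - (f₁.hom + g₁.hom)
  rw [biprod.lift_desc, hab', hcd']
  abel

include hE hWF in
lemma homotopic_congruence : Congruence (homotopic W F) where
  comp_left f g g' h := by
    obtain ⟨I, a, b, hI, hab⟩ := h
    exact ⟨I, f ≫ a, b, hI, by rw [Category.assoc, hab, Preadditive.comp_sub]⟩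
  comp_right g h := by
    obtain ⟨I, a, b, hI, hab⟩ := h
    exact ⟨I, a, b ≫ g, hI, by rw [reassoc_of% hab, Preadditive.sub_comp]⟩
  equivalence := by
    intro X Y
    have hrefl : ∀ f : X ⟶ Y, homotopic W F f f := fun f => by
      obtain ⟨Z, hZ⟩ := hE.hasZeroObject
      exact ⟨⟨Z, hWF.right_of_isZero hZ⟩, 0, 0, hWF.left_of_isZero hZ, by simp⟩
    refine ⟨hrefl, fun {f g} h => ?_, fun {f g k} h h' => ?_⟩
    · obtain ⟨I, a, b, hI, hab⟩ := h
      exact ⟨I, a, -b, hI, by rw [Preadditive.comp_neg, hab, neg_sub]⟩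
    · obtain ⟨I, a, b, hI, hab⟩ := homotopic_add hE hWF h h'
      exact ⟨I, a, b, hI, by rw [hab]; abel⟩

include hE hWF in
/-- Morphisms of the right class which agree on a trivial cofibration are homotopic. -/
lemma homotopic_of_comp_eq {X Q : A} {R R' : F.FullSubcategory} {j : X ⟶ R.obj} {p : R.obj ⟶ Q}
    (h : Conf E j p) (hQ : W Q) {f g : R ⟶ R'} (hfg : j ≫ f.hom = j ≫ g.hom) :
    homotopic W F f g := by
  obtain ⟨t, ht⟩ := hE.desc h (g.hom - f.hom) (by rw [Preadditive.comp_sub, hfg, sub_self])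
  -- The difference factors through `Q`, which is only in `W`. Its fibrant replacement `S` lies in
  -- `W ∩ F`, and the second factor extends over `S` because its target is in `F`.
  obtain ⟨S, V, k, q, hk, hS, hV⟩ := hWF.exists_fibrantReplacement hE Q
  obtain ⟨t', ht'⟩ := hWF.exists_extension hE hk hV R'.property t
  exact ⟨⟨S, hS⟩, ObjectProperty.homMk (p ≫ k), ObjectProperty.homMk t',
    hWF.thick.middle _ hk.2 hQ hV, F.hom_ext (by
      change (p ≫ k) ≫ t' = g.hom - f.hom
      rw [Category.assoc, ht', ht])⟩

include hE hWF in
lemma functor_map_eq_of_comp_eq {X : A} {R R' : F.FullSubcategory} {j : X ⟶ R.obj}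
    (h : trivialCofibrations E W j) {f g : R ⟶ R'} (hfg : j ≫ f.hom = j ≫ g.hom) :
    (Quotient.functor (homotopic W F)).map f = (Quotient.functor (homotopic W F)).map g := by
  obtain ⟨Q, p, hp, hQ⟩ := trivialCofibrations_conf h
  exact CategoryTheory.Quotient.sound _ (homotopic_of_comp_eq hE hWF hp hQ hfg)

include hE hWF in
lemma trivialCofibrations_comp {X Y Z : A} {i : X ⟶ Y} {j : Y ⟶ Z}
    (hi : trivialCofibrations E W i) (hj : trivialCofibrations E W j) :
    trivialCofibrations E W (i ≫ j) := by
  obtain ⟨Q, p, hp, hQ⟩ := trivialCofibrations_conf hi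
  obtain ⟨V, q, hq, hV⟩ := trivialCofibrations_conf hj
  obtain ⟨P, f, k, s, h₁, h₂, -, -⟩ := hE.exists_noether hp hq
  exact trivialCofibrations_of_conf h₁ (hWF.thick.middle _ h₂.2 hQ hV)

include hE hWF in
/-- A map between fibrant replacements along a trivial cofibration is invertible up to homotopy. -/
lemma isIso_functor_map {X Y : A} {R R' : F.FullSubcategory} {j : X ⟶ R.obj} {j' : Y ⟶ R'.obj}
    {i : X ⟶ Y} (hi : trivialCofibrations E W i) (hj : trivialCofibrations E W j)
    (hj' : trivialCofibrations E W j') (f : R ⟶ R') (hf : j ≫ f.hom = i ≫ j') :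
    IsIso ((Quotient.functor (homotopic W F)).map f) := by
  have hij := trivialCofibrations_comp hE hWF hi hj'
  obtain ⟨P, q, hq, hP⟩ := trivialCofibrations_conf hij
  obtain ⟨g, hg⟩ := hWF.exists_extension hE hq hP R.property j
  refine ⟨(Quotient.functor (homotopic W F)).map (ObjectProperty.homMk g), ?_, ?_⟩
  · rw [← Functor.map_comp, ← CategoryTheory.Functor.map_id]
    exact functor_map_eq_of_comp_eq hE hWF hj
      (by change j ≫ f.hom ≫ g = j ≫ 𝟙 _; rw [reassoc_of% hf, ← Category.assoc, hg, Category.comp_id])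
  · rw [← Functor.map_comp, ← CategoryTheory.Functor.map_id]
    exact functor_map_eq_of_comp_eq hE hWF hij
      (by change (i ≫ j') ≫ g ≫ f.hom = (i ≫ j') ≫ 𝟙 _; rw [← Category.assoc, hg, hf, Category.comp_id])

include hE hWF in
lemma trivialCofibrations_id (X : A) : trivialCofibrations E W (𝟙 X) := by
  obtain ⟨Z, hZ⟩ := hE.hasZeroObject
  exact trivialCofibrations_of_conf (hE.conf_of_splitting (p := (0 : X ⟶ Z)) (by simp)
    ⟨𝟙 _, 0, by simp, hZ.eq_of_src _ _, by simp⟩) (hWF.left_of_isZero hZ)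

section FibrantReplacement

variable {r : A → F.FullSubcategory} {j : ∀ X : A, X ⟶ (r X).obj}
  (hj : ∀ X, trivialCofibrations E W (j X)) {m : ∀ X Y : A, (X ⟶ Y) → (r X ⟶ r Y)}
  (hm : ∀ (X Y : A) (f : X ⟶ Y), j X ≫ (m X Y f).hom = f ≫ j Y)

/-- Fibrant replacement, as a functor to the quotient of the right class by homotopy. -/
@[simps]
def fibrantReplacementFunctor : A ⥤ StableCategory W F where
  obj X := (Quotient.functor (homotopic W F)).obj (r X)
  map f := (Quotient.functor (homotopic W F)).map (m _ _ f)
  map_id X := by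
    rw [← CategoryTheory.Functor.map_id]
    exact functor_map_eq_of_comp_eq hE hWF (hj X) (by
      rw [hm, Category.id_comp]
      exact (Category.comp_id _).symm)
  map_comp {X Y Z} f g := by
    rw [← Functor.map_comp]
    exact functor_map_eq_of_comp_eq hE hWF (hj X) (by
      change _ = j X ≫ (m _ _ f).hom ≫ (m _ _ g).hom
      rw [hm, reassoc_of% hm _ _ f, hm, Category.assoc])

lemma fibrantReplacementFunctor_inverts :
    (weakEquivalences E W F).IsInvertedBy (fibrantReplacementFunctor hE hWF hj hm) :=
  isInvertedBy_weakEquivalences hE hWF _ fun _ _ i hi =>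
    isIso_functor_map hE hWF hi (hj _) (hj _) _ (hm _ _ i)

/-- The functor from the stable category to the homotopy category induced by the inclusion. -/
noncomputable def stableToHomotopy : StableCategory W F ⥤ HomotopyCategory E W F :=
  CategoryTheory.Quotient.lift _ (F.ι ⋙ localizationFunctor E W F)
    fun _ _ _ _ h => localizationFunctor_map_eq hE hWF h

/-- The functor from the homotopy category to the stable category induced by fibrant
replacement. -/
noncomputable def homotopyToStable : HomotopyCategory E W F ⥤ StableCategory W F :=
  Localization.Construction.lift _ (fibrantReplacementFunctor_inverts hE hWF hj hm)

lemma localizationFunctor_comp_homotopyToStable :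
    localizationFunctor E W F ⋙ homotopyToStable hE hWF hj hm =
      fibrantReplacementFunctor hE hWF hj hm :=
  Localization.Construction.fac _ _

/-- Fibrant replacement is isomorphic to the identity in the homotopy category. -/
noncomputable def localizationFunctorIso :
    localizationFunctor E W F ≅
      fibrantReplacementFunctor hE hWF hj hm ⋙ stableToHomotopy hE hWF :=
  NatIso.ofComponents
    (fun X => @asIso _ _ _ _ ((localizationFunctor E W F).map (j X))
      (isIso_localizationFunctor_map hE hWF (hj X)))
    (fun {X Y} f => by
      change (localizationFunctor E W F).map f ≫ (localizationFunctor E W F).map (j Y) =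
        (localizationFunctor E W F).map (j X) ≫ (localizationFunctor E W F).map (m _ _ f).hom
      rw [← Functor.map_comp, ← Functor.map_comp, hm])

/-- Fibrant replacement is isomorphic to the identity on the right class. -/
noncomputable def functorIso :
    Quotient.functor (homotopic W F) ≅ F.ι ⋙ fibrantReplacementFunctor hE hWF hj hm :=
  NatIso.ofComponents
    (fun X => @asIso _ _ _ _ ((Quotient.functor (homotopic W F)).map
      (ObjectProperty.homMk (j X.obj) : X ⟶ r X.obj))
      (isIso_functor_map hE hWF (trivialCofibrations_id hE hWF X.obj)
        (trivialCofibrations_id hE hWF X.obj) (hj X.obj) _ rfl))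
    (fun {X Y} f => by
      change (Quotient.functor (homotopic W F)).map f ≫ (Quotient.functor (homotopic W F)).map _ =
        (Quotient.functor (homotopic W F)).map _ ≫ (Quotient.functor (homotopic W F)).map _
      rw [← Functor.map_comp, ← Functor.map_comp]
      exact congrArg _ (F.hom_ext (hm _ _ f.hom).symm))

/-- The lift of `localizationFunctorIso` to the homotopy category. -/
noncomputable def homotopyToStableCompIso :
    homotopyToStable hE hWF hj hm ⋙ stableToHomotopy hE hWF ≅ 𝟭 (HomotopyCategory E W F) :=
  letI : Localization.Lifting (localizationFunctor E W F) (weakEquivalences E W F)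
      (fibrantReplacementFunctor hE hWF hj hm) (homotopyToStable hE hWF hj hm) :=
    ⟨eqToIso (localizationFunctor_comp_homotopyToStable hE hWF hj hm)⟩
  Localization.liftNatIso (localizationFunctor E W F) (weakEquivalences E W F)
    (fibrantReplacementFunctor hE hWF hj hm ⋙ stableToHomotopy hE hWF)
    (localizationFunctor E W F) _ _ (localizationFunctorIso hE hWF hj hm).symm

/-- The stable category of the right class is equivalent to the homotopy category. -/
noncomputable def stableEquivalence : StableCategory W F ≌ HomotopyCategory E W F :=
  CategoryTheory.Equivalence.mk (stableToHomotopy hE hWF) (homotopyToStable hE hWF hj hm)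
    (Quotient.natIsoLift _ (functorIso hE hWF hj hm ≪≫ Functor.isoWhiskerLeft F.ι
      (eqToIso (localizationFunctor_comp_homotopyToStable hE hWF hj hm).symm)))
    (homotopyToStableCompIso hE hWF hj hm)

end FibrantReplacement

include hE hWF in
theorem exists_stableEquivalence :
    ∃ e : StableCategory W F ≌ HomotopyCategory E W F,
      Quotient.functor (homotopic W F) ⋙ e.functor = F.ι ⋙ localizationFunctor E W F := by
  choose R₀ Q j p hp hR hQ using hWF.exists_fibrantReplacement hE
  have hm : ∀ (X Y : A) (f : X ⟶ Y), ∃ g : (⟨R₀ X, hR X⟩ : F.FullSubcategory) ⟶ ⟨R₀ Y, hR Y⟩,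
      j X ≫ g.hom = f ≫ j Y := fun X Y f => by
    obtain ⟨g, hg⟩ := hWF.exists_extension hE (hp X) (hQ X) (hR Y) (f ≫ j Y)
    exact ⟨ObjectProperty.homMk g, hg⟩
  choose m hm using hm
  exact ⟨stableEquivalence hE hWF (r := fun X => ⟨R₀ X, hR X⟩) (j := j)
    (fun X => trivialCofibrations_of_conf (hp X) (hQ X)) hm, rfl⟩

end Localization

/-! ### Exactness and universality of the localization functor -/

section Main

lemma distTriang_of_iso {D : Type u} [Category.{v} D] [Preadditive D] [HasZeroObject D]
    [HasShift D ℤ] [∀ n : ℤ, (shiftFunctor D n).Additive] [Pretriangulated D]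
    {X Y Z X' Y' Z' : D} {f : X ⟶ Y} {g : Y ⟶ Z} {f' : X' ⟶ Y'} {g' : Y' ⟶ Z'}
    (h : ∃ δ' : Z' ⟶ X'⟦(1 : ℤ)⟧, Triangle.mk f' g' δ' ∈ distTriang D) (e₁ : X ≅ X')
    (e₂ : Y ≅ Y') (e₃ : Z ≅ Z') (h₁ : f ≫ e₂.hom = e₁.hom ≫ f')
    (h₂ : g ≫ e₃.hom = e₂.hom ≫ g') :
    ∃ δ : Z ⟶ X⟦(1 : ℤ)⟧, Triangle.mk f g δ ∈ distTriang D := by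
  obtain ⟨δ, hδ⟩ := h
  exact ⟨e₃.hom ≫ δ ≫ e₁.inv⟦(1 : ℤ)⟧', isomorphic_distinguished _ hδ _
    (triangleMkIso e₁ e₂ e₃ h₁ h₂ (by simp [← Functor.map_comp]))⟩

lemma IsStableTriangulation.exists_distTriang {B : Type u} [Category.{v} B] [Preadditive B]
    {E : ObjectProperty (ShortComplex B)} (hE : IsFrobenius E) {D : Type u₂} [Category.{v₂} D]
    [Preadditive D] [HasZeroObject D] [HasShift D ℤ] [∀ n : ℤ, (shiftFunctor D n).Additive]
    [Pretriangulated D] {π : B ⥤ D} (h : IsStableTriangulation E π) : IsExactFunctor E π := by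
  intro S hS
  obtain ⟨-, σ, -, hσ⟩ := h
  obtain ⟨I, i, hI, Z, p, w, h⟩ := hE.enoughInjectives S.X₁
  obtain ⟨φ, hφ⟩ := hE.exact.exists_hom_of_injective hS (S' := ShortComplex.mk i p w) hI (𝟙 _)
  exact ⟨_, (hσ _).2 ⟨S, hS, I, Z, i, p, w, h, hI, φ.τ₂, φ.τ₃,
    by simpa [hφ] using φ.comm₁₂.symm, φ.comm₂₃.symm, ⟨Iso.refl _⟩⟩⟩

variable {A : Type u} [Category.{v} A] [Preadditive A] {E : ObjectProperty (ShortComplex A)}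
  (hE : IsExactCategory E) {W F : ObjectProperty A} (hWF : IsInjectiveCotorsionPair E W F)

include hE hWF

/-- The homotopy category is the stable category of the right class. -/
lemma exists_isStableQuotient (hI : HasEnoughInjectives E) :
    ∃ _ : Preadditive (HomotopyCategory E W F),
      IsStableQuotient (restrict E F) (F.ι ⋙ localizationFunctor E W F) := by
  have := homotopic_congruence hE hWF
  obtain ⟨e, he⟩ := exists_stableEquivalence hE hWF
  have hr : ∀ ⦃X Y : F.FullSubcategory⦄ (f₁ f₂ g₁ g₂ : X ⟶ Y), homotopic W F f₁ f₂ →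
      homotopic W F g₁ g₂ → homotopic W F (f₁ + g₁) (f₂ + g₂) :=
    fun _ _ _ _ _ _ h h' => homotopic_add hE hWF h h'
  let _ : Preadditive (StableCategory W F) := CategoryTheory.Quotient.preadditive _ hr
  have h₁ : (Quotient.functor (homotopic W F)).Additive :=
    CategoryTheory.Quotient.functor_additive _ hr
  -- The localization has no additive structure of its own; it is transported from `F/∼`, making `e`
  -- additive in both directions.
  let _ : Preadditive (HomotopyCategory E W F) := .ofFullyFaithful e.fullyFaithfulInverse
  have h₂ : e.inverse.Additive := e.fullyFaithfulInverse.additive_ofFullyFaithful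
  have : e.symm.functor.Additive := h₂
  have h₃ : e.functor.Additive := e.symm.inverse_additive
  refine ⟨inferInstance, ?_⟩
  rw [← he]
  refine ⟨inferInstance, inferInstance, inferInstance, fun {X Y} f => ?_⟩
  rw [Functor.comp_map, e.functor.map_eq_zero_iff,
    ← (Quotient.functor (homotopic W F)).map_zero, eq_comm,
    CategoryTheory.Quotient.functor_map_eq_iff]
  refine ⟨?_, ?_⟩
  · rintro ⟨I, a, b, hI', hab⟩
    exact ⟨I, a, b, isInjective_restrict ((hWF.inter_iff _).1 ⟨hI', I.property⟩), by simpa using hab⟩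
  · rintro ⟨I, a, b, hI', hab⟩
    exact ⟨I, a, b, ((hWF.inter_iff _).2 ((isInjective_restrict_iff hE hWF hI I).1 hI')).1,
      by simpa using hab⟩

/-- Every conflation maps to a conflation of the right class by trivial cofibrations. -/
lemma exists_fibrantReplacement_conf {S : ShortComplex A} (hS : E S) :
    ∃ (S' : ShortComplex F.FullSubcategory) (_ : restrict E F S') (a : S.X₁ ⟶ S'.X₁.obj)
      (b : S.X₂ ⟶ S'.X₂.obj) (c : S.X₃ ⟶ S'.X₃.obj), trivialCofibrations E W a ∧
      trivialCofibrations E W b ∧ trivialCofibrations E W c ∧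
      S.f ≫ b = a ≫ S'.f.hom ∧ S.g ≫ c = b ≫ S'.g.hom := by
  obtain ⟨R₁, Q₁, j₁, p₁, h₁, hR₁, hQ₁⟩ := hWF.exists_fibrantReplacement hE S.X₁
  obtain ⟨Y, f, i, q, hP, hi, hq⟩ := hE.exists_pushout (conf_of_mem hS) j₁
  obtain ⟨p, hp, -⟩ := hE.exists_conf_of_isPushout h₁ hP.flip
  obtain ⟨R₂, Q₂, j₂, p₂, h₂, hR₂, hQ₂⟩ := hWF.exists_fibrantReplacement hE Y
  -- With the first two terms replaced, the third is forced: `R₃` is the cokernel of `R₁ ↣ R₂`, and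
  -- `S.X₃ ↣ R₃` has the same cokernel `Q₂` as `Y ↣ R₂`.
  obtain ⟨R₃, g, k, s, h₃, h₄, hP', -⟩ := hE.exists_noether hi h₂
  refine ⟨ShortComplex.mk (X₁ := ⟨R₁, hR₁⟩) (X₂ := ⟨R₂, hR₂⟩)
    (X₃ := ⟨R₃, hWF.right_cokernel hE h₃ hR₁ hR₂⟩) (ObjectProperty.homMk (i ≫ j₂))
    (ObjectProperty.homMk g) (F.hom_ext h₃.w), h₃.2, j₁, f ≫ j₂, k,
    trivialCofibrations_of_conf h₁ hQ₁,
    trivialCofibrations_comp hE hWF (trivialCofibrations_of_conf hp hQ₁)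
      (trivialCofibrations_of_conf h₂ hQ₂), trivialCofibrations_of_conf h₄ hQ₂, ?_, ?_⟩
  · exact hP.w_assoc _
  · dsimp
    rw [Category.assoc, hP'.w, reassoc_of% hq]

lemma isExactFunctor_localizationFunctor [Preadditive (HomotopyCategory E W F)]
    [HasZeroObject (HomotopyCategory E W F)] [HasShift (HomotopyCategory E W F) ℤ]
    [∀ n : ℤ, (shiftFunctor (HomotopyCategory E W F) n).Additive]
    [Pretriangulated (HomotopyCategory E W F)]
    (h : IsExactFunctor (restrict E F) (F.ι ⋙ localizationFunctor E W F)) :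
    IsExactFunctor E (localizationFunctor E W F) := by
  intro S hS
  obtain ⟨S', hS', a, b, c, ha, hb, hc, h₁, h₂⟩ := exists_fibrantReplacement_conf hE hWF hS
  have := isIso_localizationFunctor_map hE hWF ha
  have := isIso_localizationFunctor_map hE hWF hb
  have := isIso_localizationFunctor_map hE hWF hc
  refine distTriang_of_iso (h S' hS') (asIso ((localizationFunctor E W F).map a))
    (asIso ((localizationFunctor E W F).map b)) (asIso ((localizationFunctor E W F).map c)) ?_ ?_
  · rw [asIso_hom, ← Functor.map_comp, h₁, Functor.map_comp]
    rfl
  · rw [asIso_hom, ← Functor.map_comp, h₂, Functor.map_comp]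
    rfl

/-- For `X` in `W`, the map from a zero object to `X` is a trivial cofibration. -/
lemma isZero_localizationFunctor_obj [HasZeroMorphisms (HomotopyCategory E W F)]
    [(F.ι ⋙ localizationFunctor E W F).PreservesZeroMorphisms] {X : A} (hX : W X) :
    IsZero ((localizationFunctor E W F).obj X) := by
  obtain ⟨Z, hZ⟩ := hE.hasZeroObject
  have h₀ : IsZero (⟨Z, hWF.right_of_isZero hZ⟩ : F.FullSubcategory) := by
    rw [IsZero.iff_id_eq_zero]
    exact F.hom_ext (hZ.eq_of_src _ _)
  have h₁ : Conf E (0 : Z ⟶ X) (𝟙 X) := hE.conf_of_splitting (by simp)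
    ⟨0, 𝟙 _, hZ.eq_of_src _ _, by simp, by simp⟩
  have := isIso_localizationFunctor_map hE hWF (trivialCofibrations_of_conf h₁ hX)
  exact ((F.ι ⋙ localizationFunctor E W F).map_isZero h₀).of_iso
    (asIso ((localizationFunctor E W F).map (0 : Z ⟶ X))).symm

/-- An exact functor which kills the left class inverts the weak equivalences. -/
lemma IsExactFunctor.isInvertedBy {T : Type u₂} [Category.{v₂} T] [Preadditive T]
    [HasZeroObject T] [HasShift T ℤ] [∀ n : ℤ, (shiftFunctor T n).Additive] [Pretriangulated T]
    {G : A ⥤ T} (hG : IsExactFunctor E G) (hG' : ∀ X : A, W X → IsZero (G.obj X)) :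
    (weakEquivalences E W F).IsInvertedBy G :=
  isInvertedBy_weakEquivalences hE hWF G fun X Y i hi => by
    obtain ⟨Z, p, hp, hZ⟩ := trivialCofibrations_conf hi
    obtain ⟨δ, hδ⟩ := hG _ hp.2
    exact (Triangle.isZero₃_iff_isIso₁ _ hδ).1 (hG' Z hZ)

end Main

end ExactCat

open ExactCat in
theorem mainTheorem3 {A : Type u} [Category.{v} A] [Preadditive A]
    (E : ObjectProperty (ShortComplex A)) (hE : IsExactCategory E)
    (hA : IsWeaklyIdempotentComplete A) (hI : HasEnoughInjectives E)
    (W F : ObjectProperty A) (hWF : IsInjectiveCotorsionPair E W F) :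
    -- `F` is Frobenius and its projective-injectives are the injectives of `A`
    (IsFrobenius (restrict E F) ∧
      (∀ X : A, (∃ hX : F X, IsProjective (restrict E F) ⟨X, hX⟩ ∧
        IsInjective (restrict E F) ⟨X, hX⟩) ↔ IsInjective E X)) ∧
    -- the inclusion of `F` induces an equivalence `F/∼ ≌ A/W`
    (∃ e : StableCategory W F ≌ HomotopyCategory E W F,
      Nonempty (Quotient.functor (homotopic W F) ⋙ e.functor ≅
        F.ι ⋙ localizationFunctor E W F)) ∧
    -- `A/W` is triangulated, with the structure of the stable category of `F`
    ∃ (_ : Preadditive (HomotopyCategory E W F)) (_ : HasZeroObject (HomotopyCategory E W F))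
      (_ : HasShift (HomotopyCategory E W F) ℤ)
      (_ : ∀ n : ℤ, (shiftFunctor (HomotopyCategory E W F) n).Additive)
      (_ : Pretriangulated (HomotopyCategory E W F)),
      IsTriangulated (HomotopyCategory E W F) ∧
      IsStableTriangulation (restrict E F) (F.ι ⋙ localizationFunctor E W F) ∧
      -- `γ` is exact and kills `W`
      IsExactFunctor E (localizationFunctor E W F) ∧
      (∀ X : A, W X → IsZero ((localizationFunctor E W F).obj X)) ∧
      -- `γ` is universal with these properties
      (∀ (T : Type u₂) [Category.{v₂} T] [Preadditive T] [HasZeroObject T] [HasShift T ℤ]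
        [∀ n : ℤ, (shiftFunctor T n).Additive] [Pretriangulated T] [IsTriangulated T]
        (G : A ⥤ T), IsExactFunctor E G → (∀ X : A, W X → IsZero (G.obj X)) →
        ∃ H : HomotopyCategory E W F ⥤ T,
          localizationFunctor E W F ⋙ H = G ∧
          (∀ H' : HomotopyCategory E W F ⥤ T, localizationFunctor E W F ⋙ H' = G → H' = H) ∧
          (∀ Δ ∈ distTriang (HomotopyCategory E W F),
            ∃ δ : H.obj Δ.obj₃ ⟶ (H.obj Δ.obj₁)⟦(1 : ℤ)⟧,
              Triangle.mk (H.map Δ.mor₁) (H.map Δ.mor₂) δ ∈ distTriang T)) := by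
  have hF := isFrobenius_restrict hE hWF hI
  refine ⟨⟨hF, projective_injective_restrict_iff hE hWF hI⟩, ?_, ?_⟩
  · obtain ⟨e, he⟩ := exists_stableEquivalence hE hWF
    exact ⟨e, ⟨eqToIso he⟩⟩
  · obtain ⟨_, hπ⟩ := exists_isStableQuotient hE hWF hI
    obtain ⟨_, _, _, _, hT, hS⟩ := hπ.exists_triangulation hF
    have := hπ.additive
    refine ⟨inferInstance, inferInstance, inferInstance, inferInstance, inferInstance, hT, hS,
      isExactFunctor_localizationFunctor hE hWF (hS.exists_distTriang hF),
      fun X hX => isZero_localizationFunctor_obj hE hWF hX, ?_⟩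
    intro T _ _ _ _ _ _ _ G hG hG'
    obtain ⟨H, hH⟩ : ∃ H, localizationFunctor E W F ⋙ H = G :=
      ⟨_, Localization.Construction.fac G (hG.isInvertedBy hE hWF hG')⟩
    refine ⟨H, hH, fun H' hH' => Localization.Construction.uniq _ _ (hH'.trans hH.symm), ?_⟩
    intro Δ hΔ
    subst hH
    obtain ⟨-, σ, -, hσ⟩ := hS
    -- The triangle comes from a conflation `S` in `F`, to which exactness of the composite of `γ`
    -- with `H` applies. The new connecting morphism is only asserted to exist, so the third square
    -- of `t` is not needed.
    obtain ⟨S, hS, I, Z, i, p, w, hS', hI', e, c, -, -, ⟨t⟩⟩ := (hσ Δ).1 hΔ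
    let t₁ : Δ.obj₁ ≅ (F.ι ⋙ localizationFunctor E W F).obj S.X₁ := Triangle.π₁.mapIso t
    let t₂ : Δ.obj₂ ≅ (F.ι ⋙ localizationFunctor E W F).obj S.X₂ := Triangle.π₂.mapIso t
    let t₃ : Δ.obj₃ ≅ (F.ι ⋙ localizationFunctor E W F).obj S.X₃ := Triangle.π₃.mapIso t
    have c₁ : Δ.mor₁ ≫ t₂.hom = t₁.hom ≫ (F.ι ⋙ localizationFunctor E W F).map S.f := t.hom.comm₁
    have c₂ : Δ.mor₂ ≫ t₃.hom = t₂.hom ≫ (F.ι ⋙ localizationFunctor E W F).map S.g := t.hom.comm₂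
    refine distTriang_of_iso (hG _ hS) (H.mapIso t₁) (H.mapIso t₂) (H.mapIso t₃) ?_ ?_
    · rw [Functor.mapIso_hom, ← H.map_comp, c₁, H.map_comp]
      rfl
    · rw [Functor.mapIso_hom, ← H.map_comp, c₂, H.map_comp]
      rfl
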